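/- Let $\Gamma$ be a finite group, regarded as a discrete topological group. For a non-archimedean local field $K$ (of any characteristic) let $G_K=\mathrm{Gal}(K^{\mathrm{sep}}/K)$ be its absolute Galois group, $I_K\subset G_K$ its inertia subgroup, and $q_K$ the cardinality of its residue field; let $S_{K,\Gamma}$ be the set of continuous homomorphisms $\rho\colon G_K\to\Gamma$. A \emph{counting function} for $\Gamma$ is a function $c$ assigning to every $\rho\in S_{K,\Gamma}$, for all local fields $K$, an integer $c(\rho)\ge 0$, such that $c(\gamma\rho\gamma^{-1})=c(\rho)$ for all $\gamma\in\Gamma$. It is \emph{proper} if $c(\rho)=c(\rho')$ whenever $\rho\in S_{K,\Gamma}$ and $\rho'\in S_{K',\Gamma}$ satisfy $\rho(I_K)=\rho'(I_{K'})$ and both $q_K$ and $q_{K'}$ are relatively prime to $|\Gamma|$. Put $$M(K,\Gamma,c)=\sum_{\rho\in S_{K,\Gamma}}\frac{1}{q_K^{c(\rho)}}\in[0,\infty].$$ For a class $S$ of local fields, $(\Gamma,c)$ \emph{has a mass formula for $S$} if there is a polynomial $f\in\mathbb{Z}[x]$ such that $M(K,\Gamma,c)=f(1/q_K)$ (in particular,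 the mass is finite) for all $K\in S$. \textbf{Proposition.} Let $c$ be a proper counting function for $\Gamma$. Then $(\Gamma,c)$ has a mass formula for the class of all local fields $K$ with $q_K$ relatively prime to $|\Gamma|$ if and only if $\Gamma$ has a rational character table, that is, all values of all irreducible complex characters of $\Gamma$ are rational. -/

import Mathlib

open scoped ValuativeRel ENNReal

universe u v

/-- The absolute Galois group `G_K = Gal(K^sep/K)`, with its Krull topology. -/
abbrev AbsGal (K : Type u) [Field K] : Type u := Gal(SeparableClosure K/K)

/-- The inertia subgroup `I_K` of `G_K` for a (non-archimedean) local field `K`: the automorphisms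
acting trivially on the residue field of the ring of integers `O` of `K^sep`, where `O` is the
integral closure of `𝒪[K]` in `K^sep`. As `𝒪[K]` is a complete discrete valuation ring, `O` is a
local ring, so that its Jacobson radical is its maximal ideal. -/
noncomputable def inertiaGroup (K : Type u) [Field K] [ValuativeRel K] [TopologicalSpace K]
    [IsNonarchimedeanLocalField K] : Subgroup (AbsGal K) :=
  (Ring.jacobson (integralClosure 𝒪[K] (SeparableClosure K))).inertia (AbsGal K)

/-- The number `q_K` of elements of the residue field of a local field `K`. -/
noncomputable def residueCard (K : Type u) [Field K] [ValuativeRel K] [TopologicalSpace K]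
    [IsNonarchimedeanLocalField K] : ℕ :=
  Nat.card 𝓀[K]

/-- A counting function for `Γ`: it assigns a natural number to every continuous homomorphism
`G_K → Γ`, for all local fields `K`, and is invariant under conjugation by elements of `Γ`.
(Invariance under isomorphisms of `K` is not demanded; a function that is only given on one
representative of every isomorphism class of local fields extends to all of them by transport.) -/
structure CountingFunction (Γ : Type v) [Group Γ] [TopologicalSpace Γ] where
  /-- the value `c(ρ)` -/
  toFun : ∀ {K : Type u} [Field K] [ValuativeRel K] [TopologicalSpace K]
    [IsNonarchimedeanLocalField K], (AbsGal K →ₜ* Γ) → ℕ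
  /-- `c(γ ρ γ⁻¹) = c(ρ)` -/
  conj_invariant : ∀ {K : Type u} [Field K] [ValuativeRel K] [TopologicalSpace K]
    [IsNonarchimedeanLocalField K] (γ : Γ) (ρ ρ' : AbsGal K →ₜ* Γ),
    (∀ s, ρ' s = γ * ρ s * γ⁻¹) → toFun ρ' = toFun ρ

namespace CountingFunction

variable {Γ : Type v} [Group Γ] [TopologicalSpace Γ]

/-- `c` is proper: for local fields whose residue cardinality is prime to `|Γ|`, the value `c(ρ)`
depends only on the image of inertia `ρ(I_K)`, a subgroup of `Γ`. -/
def IsProper (c : CountingFunction.{u, v} Γ) : Prop :=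
  ∀ (K K' : Type u) [Field K] [ValuativeRel K] [TopologicalSpace K] [IsNonarchimedeanLocalField K]
    [Field K'] [ValuativeRel K'] [TopologicalSpace K'] [IsNonarchimedeanLocalField K']
    (ρ : AbsGal K →ₜ* Γ) (ρ' : AbsGal K' →ₜ* Γ),
    (residueCard K).Coprime (Nat.card Γ) → (residueCard K').Coprime (Nat.card Γ) →
    (inertiaGroup K).map (ρ : AbsGal K →* Γ) = (inertiaGroup K').map (ρ' : AbsGal K' →* Γ) →
    c.toFun ρ = c.toFun ρ'

/-- The total mass `M(K, Γ, c) = ∑_ρ q_K ^ (-c(ρ))`, the sum being over all continuous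
homomorphisms `ρ : G_K → Γ`; it is `∞` if the sum diverges. -/
noncomputable def totalMass (c : CountingFunction.{u, v} Γ) (K : Type u) [Field K] [ValuativeRel K]
    [TopologicalSpace K] [IsNonarchimedeanLocalField K] : ℝ≥0∞ :=
  ∑' ρ : AbsGal K →ₜ* Γ, ((residueCard K : ℝ≥0∞) ^ c.toFun ρ)⁻¹

/-- `(Γ, c)` has a mass formula for the class `S` of local fields: there is one `f ∈ ℤ[x]` such
that `M(K, Γ, c)` is finite and equal to `f(1 / q_K)` for all `K` in `S`. -/
def HasMassFormula (c : CountingFunction.{u, v} Γ)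
    (S : ∀ (K : Type u) [Field K] [ValuativeRel K] [TopologicalSpace K]
      [IsNonarchimedeanLocalField K], Prop) : Prop :=
  ∃ f : Polynomial ℤ, ∀ (K : Type u) [Field K] [ValuativeRel K] [TopologicalSpace K]
    [IsNonarchimedeanLocalField K], S K →
    c.totalMass K ≠ ∞ ∧ (c.totalMass K).toReal = Polynomial.aeval (1 / (residueCard K : ℝ)) f

end CountingFunction

/-- `Γ` has a rational character table: all values of the characters of the irreducible
finite-dimensional complex representations of `Γ` are rational numbers. -/
def HasRationalCharacterTable (Γ : Type v) [Group Γ] : Prop :=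
  ∀ (V : Type) [AddCommGroup V] [Module ℂ V] [FiniteDimensional ℂ V] (π : Representation ℂ Γ V),
    π.IsIrreducible → ∀ g : Γ, ∃ r : ℚ, π.character g = (r : ℂ)

/-!
If `q = q_K` is prime to `|Γ|`, a homomorphism `ρ : G_K → Γ` factors through the tame quotient of
`G_K`, which is topologically generated by a Frobenius lift `s` and a generator `t` of tame inertia
subject to `s t s⁻¹ = t ^ q`. So `ρ ↦ (ρ s, ρ t)` identifies the homomorphisms with the solutions of
`x y x⁻¹ = y ^ q` in `Γ`, the image of inertia being generated by `y`. Only finite levels of the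
tame quotient are needed: with `N = |Γ|`, it suffices to follow an `N`-th root of a uniformizer and
the roots of unity of order prime to `q`.

For a proper `c` the value `c(ρ)` is a weight of `y`, whence `M(K, Γ, c) = f_q(1 / q)`, where the
polynomial `f_q = ∑_y #{x | x y x⁻¹ = y ^ q} X ^ c(y)` depends on `q` modulo `|Γ|` only. By
Dirichlet's theorem the fields `ℚ_p` force the polynomial of a mass formula to be `f_a` for every
`a` prime to `|Γ|`. The number of `x` with `x y x⁻¹ = y ^ a` is the order of the centralizer of `y`
if `y` and `y ^ a` are conjugate and zero otherwise, so comparing `f_a(1)` with `f_1(1)` shows that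
`f_a = f_1` exactly if every `y` is conjugate to `y ^ a`. As `χ(y ^ a)` is the image of `χ(y)` under
`ζ ↦ ζ ^ a` and the irreducible characters separate the conjugacy classes, this holds for all `a`
prime to `|Γ|` exactly if all characters are rational.
-/

open Polynomial
open scoped MonoidAlgebra

section SpectralNorm

theorem exists_spectral_absoluteValue (K L : Type*) [NontriviallyNormedField K]
    [IsUltrametricDist K] [CompleteSpace K] [Field L] [Algebra K L] [Algebra.IsAlgebraic K L] :
    ∃ w : AbsoluteValue L ℝ, IsNonarchimedean w ∧ (∀ (σ : Gal(L/K)) x, w (σ x) = w x) ∧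
      ∀ x : L, w x ≤ 1 ↔ ∀ n, ‖(minpoly K x).coeff n‖ ≤ 1 :=
  ⟨⟨⟨spectralNorm K L, spectralAlgNorm_mul⟩, spectralNorm_nonneg, fun x =>
    ⟨fun h => eq_zero_of_map_spectralNorm_eq_zero h (Algebra.IsAlgebraic.isAlgebraic x),
      fun h => h ▸ spectralNorm_zero⟩, map_add_le_add (spectralAlgNorm K L)⟩,
    isNonarchimedean_spectralNorm, fun σ x => (spectralNorm_eq_of_equiv σ x).symm,
    fun x => spectralValue_le_one_iff (minpoly.monic (Algebra.IsIntegral.isIntegral x))⟩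

theorem mem_integralClosure_iff_coeff_minpoly {R K L : Type*} [CommRing R] [IsDomain R]
    [Field K] [Field L] [Algebra R K] [IsFractionRing R K] [IsIntegrallyClosed R] [Algebra K L]
    [Algebra R L] [IsScalarTower R K L] [Algebra.IsIntegral K L] (x : L) :
    x ∈ integralClosure R L ↔ ∀ n, (minpoly K x).coeff n ∈ (algebraMap R K).range := by
  rw [mem_integralClosure_iff]
  constructor
  · intro h n
    rw [minpoly.isIntegrallyClosed_eq_field_fractions' K h, coeff_map]
    exact ⟨_, rfl⟩
  · intro h
    obtain ⟨p, hp⟩ : ∃ p : R[X], p.map (algebraMap R K) = minpoly K x :=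
      (mem_lifts _).1 ((lifts_iff_coeff_lifts _).2 h)
    refine ⟨p, monic_of_injective (IsFractionRing.injective R K) ?_, ?_⟩
    · rw [hp]
      exact minpoly.monic (Algebra.IsIntegral.isIntegral x)
    · rw [← aeval_def, ← aeval_map_algebraMap K, hp, minpoly.aeval]

end SpectralNorm

/-- `w` is the absolute value of a local field `K`, with ring of integers `R`, extended to an
algebraic extension `L`: it is nonarchimedean and Galois invariant, and its unit ball is the
integral closure of `R`. These properties determine `w` up to a power. -/
structure IsLocalNorm (R K L : Type*) [CommRing R] [Field K] [Field L] [Algebra K L]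
    [Algebra R L] (w : AbsoluteValue L ℝ) : Prop where
  nonarch : IsNonarchimedean w
  map_gal : ∀ (σ : Gal(L/K)) x, w (σ x) = w x
  le_one_iff : ∀ x, w x ≤ 1 ↔ x ∈ integralClosure R L

theorem exists_isLocalNorm_of_norm_le_one_iff (R K L : Type*) [CommRing R] [IsDomain R]
    [IsIntegrallyClosed R] [NontriviallyNormedField K] [IsUltrametricDist K] [CompleteSpace K]
    [Algebra R K] [IsFractionRing R K] [Field L] [Algebra K L] [Algebra.IsAlgebraic K L]
    [Algebra R L] [IsScalarTower R K L] (hR : ∀ x : K, ‖x‖ ≤ 1 ↔ x ∈ (algebraMap R K).range) :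
    ∃ w : AbsoluteValue L ℝ, IsLocalNorm R K L w := by
  obtain ⟨w, nonarch, map_gal, le_one_iff⟩ := exists_spectral_absoluteValue K L
  refine ⟨w, nonarch, map_gal, fun x => ?_⟩
  simp only [le_one_iff, hR, mem_integralClosure_iff_coeff_minpoly (R := R) (K := K)]

theorem exists_isLocalNorm (K L : Type*) [Field K] [ValuativeRel K] [TopologicalSpace K]
    [IsNonarchimedeanLocalField K] [Field L] [Algebra K L] [Algebra.IsAlgebraic K L] :
    ∃ w : AbsoluteValue L ℝ, IsLocalNorm 𝒪[K] K L w := by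
  let := IsTopologicalAddGroup.rightUniformSpace K
  have := isUniformAddGroup_of_addCommGroup (G := K)
  obtain ⟨rank⟩ := ValuativeRel.IsRankLeOne.nonempty (R := K)
  let : (Valued.v (R := K)).RankOne :=
  { hom' := rank.emb.comp MonoidWithZeroHom.ValueGroup₀.embedding
    strictMono' := rank.strictMono.comp MonoidWithZeroHom.ValueGroup₀.embedding_strictMono }
  let : NontriviallyNormedField K := Valued.toNontriviallyNormedField K _
  have : IsUltrametricDist K := Valued.instIsUltrametricDist K _
  refine exists_isLocalNorm_of_norm_le_one_iff 𝒪[K] K L fun x => ?_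
  exact Valued.toNormedField.norm_le_one_iff.trans
    ⟨fun hx => ⟨⟨x, hx⟩, rfl⟩, fun ⟨y, hy⟩ => hy ▸ y.2⟩

namespace IsLocalNorm

variable {R K L : Type*} [CommRing R] [Field K] [Field L] [Algebra K L] [Algebra R L]
    {w : AbsoluteValue L ℝ} (h : IsLocalNorm R K L w)
include h

section UnitBall

theorem add_lt {x y : L} {c : ℝ} (hx : w x < c) (hy : w y < c) : w (x + y) < c :=
  (h.nonarch x y).trans_lt (max_lt hx hy)

theorem sub_lt {x y : L} {c : ℝ} (hx : w x < c) (hy : w y < c) : w (x - y) < c := by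
  rw [sub_eq_add_neg]
  exact h.add_lt hx (by rwa [w.map_neg])

theorem sum_lt {ι : Type*} {s : Finset ι} {f : ι → L} {c : ℝ} (hc : 0 < c)
    (hf : ∀ i ∈ s, w (f i) < c) : w (∑ i ∈ s, f i) < c :=
  Finset.sum_induction f (fun x => w x < c) (fun _ _ => h.add_lt) (by simpa using hc) hf

theorem isUnit_iff (x : integralClosure R L) : IsUnit x ↔ w x = 1 := by
  have le_one (y : integralClosure R L) : w y ≤ 1 := (h.le_one_iff _).2 y.2
  constructor
  · intro hx
    obtain ⟨y, hy⟩ := isUnit_iff_exists_inv.1 hx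
    have hxy : w x * w y = 1 := by
      rw [← map_mul, ← MulMemClass.coe_mul, hy, OneMemClass.coe_one, map_one]
    exact (le_one x).antisymm (hxy ▸ mul_le_of_le_one_right (w.nonneg _) (le_one y))
  · intro hx
    have hx0 : (x : L) ≠ 0 := w.ne_zero_iff.1 (hx ▸ one_ne_zero)
    have hinv : (x : L)⁻¹ ∈ integralClosure R L := by
      rw [← h.le_one_iff, map_inv₀, hx, inv_one]
    exact IsUnit.of_mul_eq_one ⟨_, hinv⟩ (Subtype.ext (mul_inv_cancel₀ hx0))

theorem mem_nonunits_iff (x : integralClosure R L) : x ∈ nonunits _ ↔ w x < 1 := by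
  rw [_root_.mem_nonunits_iff, h.isUnit_iff, ((h.le_one_iff _).2 x.2).lt_iff_ne]

theorem isLocalRing : IsLocalRing (integralClosure R L) :=
  IsLocalRing.of_nonunits_add fun a b ha hb => by
    rw [h.mem_nonunits_iff] at *
    exact h.add_lt ha hb

theorem mem_maximalIdeal_iff [IsLocalRing (integralClosure R L)] (x : integralClosure R L) :
    x ∈ IsLocalRing.maximalIdeal (integralClosure R L) ↔ w x < 1 := by
  rw [IsLocalRing.mem_maximalIdeal, h.mem_nonunits_iff]

theorem residue_eq_residue_iff [IsLocalRing (integralClosure R L)] (x y : integralClosure R L) :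
    IsLocalRing.residue _ x = IsLocalRing.residue _ y ↔ w (x - y) < 1 := by
  rw [← sub_eq_zero, ← map_sub, IsLocalRing.residue_eq_zero_iff, h.mem_maximalIdeal_iff,
    AddSubgroupClass.coe_sub]

end UnitBall

section ResidueChar

variable [FaithfulSMul R L]

theorem algebraMap_lt_one_iff [IsDomain R] [IsLocalRing R] (r : R) :
    w (algebraMap R L r) < 1 ↔ r ∈ IsLocalRing.maximalIdeal R := by
  rw [IsLocalRing.mem_maximalIdeal, _root_.mem_nonunits_iff,
    ← isUnit_map_iff (algebraMap R (integralClosure R L)), ← _root_.mem_nonunits_iff,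
    h.mem_nonunits_iff]
  rfl

theorem natCast_eq_one [IsDomain R] [IsLocalRing R]
    [Finite (IsLocalRing.ResidueField R)] {n : ℕ}
    (hn : (Nat.card (IsLocalRing.ResidueField R)).Coprime n) : w (n : L) = 1 := by
  refine h.nonarch.apply_natCast_le_one.antisymm (not_lt.1 fun hlt => ?_)
  have hn0 : (n : IsLocalRing.ResidueField R) = 0 := by
    rwa [← map_natCast (algebraMap R L), h.algebraMap_lt_one_iff,
      ← IsLocalRing.residue_eq_zero_iff, map_natCast] at hlt
  have hq0 : (Nat.card (IsLocalRing.ResidueField R) : IsLocalRing.ResidueField R) = 0 := by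
    have := Fintype.ofFinite (IsLocalRing.ResidueField R)
    rw [Nat.card_eq_fintype_card, Nat.cast_card_eq_zero]
  have hcop := (Nat.isCoprime_iff_coprime.2 hn).map (Int.castRingHom (IsLocalRing.ResidueField R))
  simp only [eq_intCast, Int.cast_natCast, hq0, hn0, isCoprime_zero_left, not_isUnit_zero] at hcop

end ResidueChar

section Value

variable [IsDomain R] [IsDiscreteValuationRing R] [Algebra R K] [IsFractionRing R K]
    [IsScalarTower R K L] {π : R} (hπ : Irreducible π)
include hπ

theorem exists_zpow_of_irreducible {x : K} (hx : x ≠ 0) :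
    ∃ i : ℤ, w (algebraMap K L x) = w (algebraMap R L π) ^ i := by
  obtain ⟨i, u, rfl⟩ := IsDiscreteValuationRing.exists_units_eq_smul_zpow_of_irreducible hπ hx
  refine ⟨i, ?_⟩
  have hu : w (algebraMap R L u) = 1 :=
    (h.isUnit_iff (algebraMap R (integralClosure R L) u)).1 (u.isUnit.map _)
  rw [Units.smul_def, Algebra.smul_def, map_mul, map_mul, ← IsScalarTower.algebraMap_apply, hu,
    one_mul, map_zpow₀, map_zpow₀, ← IsScalarTower.algebraMap_apply]

end Value

end IsLocalNorm

/-- `σ` acts on the residue field of the field `E`, normed by `w`, as `x ↦ x ^ n`. This is stated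
for the elements of the unit ball of `E`, as `σ` need not map `E` to itself. Inertia is the case
`E = ⊤`, `n = 1`, and the Frobenius lifts are the case `E = ⊤`, `n = q`. -/
def IsResiduePow {K L : Type*} [Field K] [Field L] [Algebra K L] (w : AbsoluteValue L ℝ)
    (E : IntermediateField K L) (n : ℕ) (σ : Gal(L/K)) : Prop :=
  ∀ x ∈ E, w x ≤ 1 → w (σ x - x ^ n) < 1

theorem exists_forall_apply_eq_pow_card_pow {k κ : Type*} [Field k] [Finite k] [Field κ]
    [Algebra k κ] (τ : κ ≃ₐ[k] κ) (k' : IntermediateField k κ) [FiniteDimensional k k'] :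
    ∃ j : ℕ, ∀ x ∈ k', τ x = x ^ Nat.card k ^ j := by
  have := Fintype.ofFinite k
  have : Finite k' := Module.finite_of_finite k
  obtain ⟨j, hj⟩ := (FiniteField.bijective_frobeniusAlgEquivOfAlgebraic_pow k k').2
    (τ.restrictNormal k')
  refine ⟨j, fun x hx => ?_⟩
  have h1 := congr_arg (algebraMap k' κ) (DFunLike.congr_fun hj ⟨x, hx⟩)
  rw [AlgEquiv.restrictNormal_commutes, AlgEquiv.coe_pow,
    FiniteField.coe_frobeniusAlgEquivOfAlgebraic_iterate, map_pow,
    ← Nat.card_eq_fintype_card] at h1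
  exact h1.symm

theorem norm_eq_one_of_pow_eq_one {L : Type*} [Field L] (w : AbsoluteValue L ℝ) {n : ℕ}
    (hn : n ≠ 0) {ζ : L} (hζ : ζ ^ n = 1) : w ζ = 1 := by
  rw [← pow_eq_one_iff_of_nonneg (w.nonneg ζ) hn, ← map_pow, hζ, map_one]

namespace IsLocalNorm

variable {R K L : Type*} [CommRing R] [Field K] [Field L] [Algebra K L] [Algebra R L]
    {w : AbsoluteValue L ℝ} (h : IsLocalNorm R K L w)
include h

section ResiduePow

variable {E : IntermediateField K L} {m n : ℕ} {σ τ : Gal(L/K)}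

theorem mem_inertia_iff [Algebra R K] [IsScalarTower R K L] :
    σ ∈ (Ring.jacobson (integralClosure R L)).inertia Gal(L/K) ↔ IsResiduePow w ⊤ 1 σ := by
  have := h.isLocalRing
  rw [IsLocalRing.ringJacobson_eq_maximalIdeal]
  constructor
  · intro hσ x _ hx
    rw [pow_one]
    exact (h.mem_maximalIdeal_iff _).1 (hσ ⟨x, (h.le_one_iff x).1 hx⟩)
  · intro hσ x
    have hx := hσ x trivial ((h.le_one_iff _).2 x.2)
    rw [pow_one] at hx
    exact (h.mem_maximalIdeal_iff _).2 hx

theorem isResiduePow_mul (hσ : IsResiduePow w ⊤ m σ) (hτ : IsResiduePow w E n τ) :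
    IsResiduePow w E (n * m) (σ * τ) := fun x hxE hx => by
  have hxn : w (x ^ n) ≤ 1 := by
    rw [map_pow]
    exact pow_le_one₀ (w.nonneg x) hx
  rw [AlgEquiv.mul_apply, pow_mul, ← sub_add_sub_cancel _ (σ (x ^ n)), ← map_sub]
  exact h.add_lt (by rw [h.map_gal]; exact hτ x hxE hx) (hσ _ trivial hxn)

theorem isResiduePow_pow (hσ : IsResiduePow w ⊤ n σ) (i : ℕ) :
    IsResiduePow w ⊤ (n ^ i) (σ ^ i) := by
  induction i with
  | zero => intro x; simp
  | succ i ih =>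
    rw [pow_succ' n, pow_succ σ]
    exact h.isResiduePow_mul ih hσ

theorem isResiduePow_inv_mul (hσ : IsResiduePow w ⊤ n σ) (hτ : IsResiduePow w E n τ) :
    IsResiduePow w E 1 (σ⁻¹ * τ) := fun x hxE hx => by
  rw [← h.map_gal σ, pow_one, map_sub, ← AlgEquiv.mul_apply, mul_inv_cancel_left,
    ← sub_sub_sub_cancel_right _ _ (x ^ n)]
  exact h.sub_lt (hτ x hxE hx) (hσ x trivial hx)

theorem eq_of_pow_eq_one {N : ℕ} (hN : w (N : L) = 1) {a b : L} (ha : a ^ N = 1) (hb : b ^ N = 1)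
    (hab : w (a - b) < 1) : a = b := by
  have hN0 : N ≠ 0 := by rintro rfl; simp at hN
  have hb0 : b ≠ 0 := by rintro rfl; simp [hN0] at hb
  by_contra hne
  set c := a / b with hc
  have hc1 : c ≠ 1 := by rwa [hc, ne_eq, div_eq_one_iff_eq hb0]
  have hcN : c ^ N = 1 := by rw [hc, div_pow, ha, hb, div_one]
  have hcw : w (c - 1) < 1 := by
    rwa [hc, div_sub_one hb0, map_div₀, norm_eq_one_of_pow_eq_one w hN0 hb, div_one]
  have hpow (i : ℕ) : w (c ^ i - 1) < 1 := by
    induction i with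
    | zero => simp
    | succ i ih =>
      rw [show c ^ (i + 1) - 1 = c * (c ^ i - 1) + (c - 1) by ring]
      refine h.add_lt ?_ hcw
      rwa [map_mul, norm_eq_one_of_pow_eq_one w hN0 hcN, one_mul]
  have hsum : ∑ i ∈ Finset.range N, (c ^ i - 1) = -(N : L) := by
    have hgeom := mul_geom_sum c N
    rw [hcN, sub_self, mul_eq_zero, or_iff_right (sub_ne_zero.2 hc1)] at hgeom
    simp [hgeom]
  have hlt : w (∑ i ∈ Finset.range N, (c ^ i - 1)) < 1 := h.sum_lt one_pos fun i _ => hpow i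
  rw [hsum, w.map_neg, hN] at hlt
  exact lt_irrefl _ hlt

theorem apply_eq_pow_of_isResiduePow {N : ℕ} (hN : w (N : L) = 1) (hσ : IsResiduePow w E n σ)
    {ζ : L} (hζE : ζ ∈ E) (hζ : ζ ^ N = 1) : σ ζ = ζ ^ n := by
  have hN0 : N ≠ 0 := by rintro rfl; simp at hN
  refine h.eq_of_pow_eq_one hN ?_ ?_ (hσ ζ hζE (norm_eq_one_of_pow_eq_one w hN0 hζ).le)
  · rw [← map_pow, hζ, map_one]
  · rw [pow_right_comm, hζ, one_pow]

end ResiduePow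

end IsLocalNorm

section ResidueField

variable {R K L : Type*} [CommRing R] [IsDomain R] [IsDiscreteValuationRing R]
    [Finite (IsLocalRing.ResidueField R)] [Field K] [Field L] [Algebra R K] [Algebra K L]
    [Algebra R L] [IsFractionRing R K] [IsScalarTower R K L] [IsGalois K L]
    {w : AbsoluteValue L ℝ} (h : IsLocalNorm R K L w)

open IsLocalRing

theorem exists_intermediateField_residue_mem [IsLocalRing (integralClosure R L)]
    [FaithfulSMul R L] (E : IntermediateField K L) [FiniteDimensional K E] :
    ∃ k' : IntermediateField (ResidueField R) (ResidueField (integralClosure R L)), Finite k' ∧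
      ∀ x : integralClosure R L, (x : L) ∈ E → residue _ x ∈ k' := by
  have : IsScalarTower R E L := IsScalarTower.of_algebraMap_eq fun r => by
    rw [IsScalarTower.algebraMap_apply R K L, IsScalarTower.algebraMap_apply R K E]
    rfl
  have : FaithfulSMul R E := FaithfulSMul.trans R K E
  let f : integralClosure R E →ₐ[R] integralClosure R L :=
    (IsScalarTower.toAlgHom R E L).mapIntegralClosure
  have hf : Function.Injective f := fun x y hxy => Subtype.ext <|
    (algebraMap E L).injective (congr_arg (algebraMap (integralClosure R L) L) hxy)
  have hint : f.toRingHom.IsIntegral := RingHom.IsIntegral.tower_top (algebraMap R _) _ <| by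
    rw [AlgHom.toRingHom_eq_coe, AlgHom.comp_algebraMap, algebraMap_isIntegral_iff]
    infer_instance
  have hlocal : IsLocalHom f.toRingHom := hint.isLocalHom hf
  have : IsLocalHom f := ⟨hlocal.map_nonunit⟩
  have : IsLocalRing (integralClosure R E) := RingHom.domain_isLocalRing f.toRingHom
  have : Module.Finite R (integralClosure R E) := IsIntegralClosure.finite R K E _
  have : Finite (ResidueField (integralClosure R E)) :=
    ResidueField.finite_of_finite (R := R) inferInstance
  refine ⟨(ResidueField.mapAlgHom' f).fieldRange, Set.finite_range (ResidueField.mapAlgHom' f),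
    fun x hx => ⟨residue _ ⟨⟨x, hx⟩, ?_⟩, rfl⟩⟩
  exact (isIntegral_algHom_iff (IsScalarTower.toAlgHom R E L) (algebraMap E L).injective).1 x.2

include h in
theorem IsLocalNorm.exists_isResiduePow (E : IntermediateField K L) [FiniteDimensional K E]
    (σ : Gal(L/K)) : ∃ j, IsResiduePow w E (Nat.card (ResidueField R) ^ j) σ := by
  have := h.isLocalRing
  have : FaithfulSMul R L := FaithfulSMul.trans R K L
  obtain ⟨k', hk', hres⟩ := exists_intermediateField_residue_mem (R := R) E
  have : Algebra.IsIntegral (ResidueField R) (ResidueField (integralClosure R L)) :=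
    Ideal.Quotient.algebra_isIntegral_of_liesOver (maximalIdeal _) (maximalIdeal R)
  let τ := ResidueField.mapAlgEquiv' (MulSemiringAction.toAlgEquiv R (integralClosure R L) σ)
  obtain ⟨j, hj⟩ := exists_forall_apply_eq_pow_card_pow τ k'
  refine ⟨j, fun x hxE hx => ?_⟩
  let y : integralClosure R L := ⟨x, (h.le_one_iff x).1 hx⟩
  exact (h.residue_eq_residue_iff (σ • y) (y ^ _)).1 (hj (residue _ y) (hres y hxE))

end ResidueField

theorem exists_forall_mk_smul_eq_of_profinite {R B G : Type*} [CommRing R] [CommRing B]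
    [Algebra R B] [Group G] [MulSemiringAction G B] [SMulCommClass G R B] [TopologicalSpace G]
    [CompactSpace G] [TotallyDisconnectedSpace G] [IsTopologicalGroup G] [TopologicalSpace B]
    [DiscreteTopology B] [ContinuousSMul G B] (Q : Ideal B) [Q.IsPrime]
    (hR : ∀ b : B, (∀ g : G, g • b = b) → ∃ r : R, b - algebraMap R B r ∈ Q)
    (φ : (B ⧸ Q) ≃ₐ[R] (B ⧸ Q)) :
    ∃ g : G, ∀ b : B, Ideal.Quotient.mk Q (g • b) = φ (Ideal.Quotient.mk Q b) := by
  let A := FixedPoints.subalgebra R B G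
  have : Algebra.IsInvariant A B G := ⟨fun b hb => ⟨⟨b, hb⟩, rfl⟩⟩
  have : SMulCommClass G A B := ⟨fun g a b => by
    rw [Algebra.smul_def, Algebra.smul_def, smul_mul']
    congr 1
    exact a.2 g⟩
  let P : Ideal A := Q.under A
  have : Q.LiesOver P := ⟨rfl⟩
  have commutes (x : A ⧸ P) : φ (algebraMap (A ⧸ P) (B ⧸ Q) x) = algebraMap (A ⧸ P) (B ⧸ Q) x := by
    obtain ⟨a, rfl⟩ := Ideal.Quotient.mk_surjective x
    obtain ⟨r, hr⟩ := hR a a.2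
    have hx : algebraMap (A ⧸ P) (B ⧸ Q) (Ideal.Quotient.mk P a) = algebraMap R (B ⧸ Q) r :=
      Ideal.Quotient.eq.2 hr
    rw [hx, φ.commutes]
  obtain ⟨g, hg⟩ := Ideal.Quotient.stabilizerHom_surjective_of_profinite (G := G) P Q
    (AlgEquiv.ofRingEquiv (f := φ.toRingEquiv) commutes)
  exact ⟨g, fun b => DFunLike.congr_fun hg (Ideal.Quotient.mk Q b)⟩

theorem ne_zero_of_pow_eq_algebraMap {R L : Type*} [CommRing R] [Field L] [Algebra R L]
    [FaithfulSMul R L] {r : R} (hr : r ≠ 0) {n : ℕ} (hn : n ≠ 0) {x : L}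
    (hx : x ^ n = algebraMap R L r) : x ≠ 0 := by
  rintro rfl
  rw [zero_pow hn, eq_comm, FaithfulSMul.algebraMap_eq_zero_iff] at hx
  exact hr hx

namespace IsLocalNorm

variable {R K L : Type*} [CommRing R] [IsDomain R] [IsDiscreteValuationRing R] [Field K] [Field L]
    [Algebra R K] [Algebra K L] [Algebra R L] [IsFractionRing R K] [IsScalarTower R K L]
    {w : AbsoluteValue L ℝ} (h : IsLocalNorm R K L w) {π : R} (hπ : Irreducible π)
    {N : ℕ} (hN : N ≠ 0) {ϖ : L} (hϖ : ϖ ^ N = algebraMap R L π)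
include h hπ hϖ

section Radical

theorem root_lt_one : w ϖ < 1 := by
  have : FaithfulSMul R L := FaithfulSMul.trans R K L
  have hlt := (h.algebraMap_lt_one_iff π).2
    ((IsDiscreteValuationRing.irreducible_iff_uniformizer π).1 hπ ▸ Ideal.mem_span_singleton_self π)
  rw [← hϖ, map_pow] at hlt
  exact lt_of_not_ge fun hle => hlt.not_ge (one_le_pow₀ hle)

theorem exists_zpow_root {a : K} (ha : a ≠ 0) :
    ∃ m : ℤ, w (algebraMap K L a) = w ϖ ^ (N * m : ℤ) := by
  obtain ⟨m, hm⟩ := h.exists_zpow_of_irreducible hπ ha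
  refine ⟨m, ?_⟩
  rw [hm, ← hϖ, map_pow, zpow_mul, zpow_natCast]

include hN

theorem norm_term_ne {a b : K} (ha : a ≠ 0) (hb : b ≠ 0) {i j : ℕ} (hi : i < N) (hj : j < N)
    (hij : i ≠ j) : w (algebraMap K L a * ϖ ^ i) ≠ w (algebraMap K L b * ϖ ^ j) := by
  obtain ⟨m, hm⟩ := h.exists_zpow_root hπ hϖ ha
  obtain ⟨n, hn⟩ := h.exists_zpow_root hπ hϖ hb
  have : FaithfulSMul R L := FaithfulSMul.trans R K L
  have hpos : 0 < w ϖ := w.pos (ne_zero_of_pow_eq_algebraMap hπ.ne_zero hN hϖ)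
  rw [map_mul, map_mul, hm, hn, map_pow, map_pow, ← zpow_natCast, ← zpow_natCast,
    ← zpow_add₀ hpos.ne', ← zpow_add₀ hpos.ne']
  intro heq
  have hmod := congr_arg (· % (N : ℤ))
    (zpow_right_injective₀ hpos (h.root_lt_one hπ hϖ).ne heq)
  simp only [Int.mul_add_emod_self_left] at hmod
  rw [Int.emod_eq_of_lt (by lia) (by lia), Int.emod_eq_of_lt (by lia) (by lia)] at hmod
  exact hij (by exact_mod_cast hmod)

theorem norm_term_le_norm_aeval {P : K[X]} (hP : P.natDegree < N) (i : ℕ) :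
    w (algebraMap K L (P.coeff i) * ϖ ^ i) ≤ w (aeval ϖ P) := by
  by_cases hi : P.coeff i = 0
  · simp [hi]
  obtain ⟨k, hk, hmax⟩ := P.support.exists_max_image
    (fun i => w (algebraMap K L (P.coeff i) * ϖ ^ i)) ⟨i, mem_support_iff.2 hi⟩
  suffices heq : w (aeval ϖ P) = w (algebraMap K L (P.coeff k) * ϖ ^ k) from
    heq ▸ hmax i (mem_support_iff.2 hi)
  have lt_of_mem {j : ℕ} (hj : j ∈ P.support) : j < N := (le_natDegree_of_mem_supp _ hj).trans_lt hP
  rw [aeval_def, eval₂_eq_sum, Polynomial.sum_def]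
  refine h.nonarch.apply_sum_eq_of_lt (fun a => (w.map_neg a).symm) hk fun j hj hjk => ?_
  exact (hmax j hj).lt_of_ne (h.norm_term_ne hπ hN hϖ (mem_support_iff.1 hj) (mem_support_iff.1 hk)
    (lt_of_mem hj) (lt_of_mem hk) hjk)

theorem aeval_root_ne_zero {P : K[X]} (hP : P.natDegree < N) (hP0 : P ≠ 0) : aeval ϖ P ≠ 0 := by
  intro h0
  have hle := h.norm_term_le_norm_aeval hπ hN hϖ hP P.natDegree
  have hlead : 0 < w (algebraMap K L P.leadingCoeff) := w.pos (by simpa using hP0)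
  have : FaithfulSMul R L := FaithfulSMul.trans R K L
  have hpos : 0 < w ϖ := w.pos (ne_zero_of_pow_eq_algebraMap hπ.ne_zero hN hϖ)
  rw [h0, map_zero, map_mul, map_pow] at hle
  exact absurd hle (not_le.2 (by positivity))

variable [Algebra.IsIntegral K L]

theorem minpoly_root : minpoly K ϖ = X ^ N - C (algebraMap R K π) := by
  have hint := Algebra.IsIntegral.isIntegral (R := K) ϖ
  have hroot : aeval ϖ (X ^ N - C (algebraMap R K π)) = 0 := by
    simp [hϖ, ← IsScalarTower.algebraMap_apply]
  refine (eq_of_monic_of_dvd_of_natDegree_le (minpoly.monic hint) (monic_X_pow_sub_C _ hN)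
    (minpoly.dvd K ϖ hroot) ?_).symm
  rw [natDegree_X_pow_sub_C]
  exact not_lt.1 fun hlt =>
    h.aeval_root_ne_zero hπ hN hϖ hlt (minpoly.ne_zero hint) (minpoly.aeval K ϖ)

theorem exists_aeval_root_eq {x : L} (hx : x ∈ IntermediateField.adjoin K {ϖ}) :
    ∃ P : K[X], aeval ϖ P = x ∧ P.natDegree < N := by
  have hint := Algebra.IsIntegral.isIntegral (R := K) ϖ
  rw [← IntermediateField.mem_toSubalgebra,
    IntermediateField.adjoin_simple_toSubalgebra_of_isAlgebraic hint.isAlgebraic,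
    Algebra.adjoin_singleton_eq_range_aeval] at hx
  obtain ⟨P, hP⟩ := hx
  refine ⟨P %ₘ minpoly K ϖ, ?_, ?_⟩
  · rw [← hP]
    exact aeval_modByMonic_eq_self_of_root (minpoly.aeval K ϖ)
  · convert natDegree_modByMonic_lt P (minpoly.monic hint) (minpoly.ne_one K ϖ)
    rw [h.minpoly_root hπ hN hϖ, natDegree_X_pow_sub_C]

theorem exists_sub_lt_one_of_mem_adjoin_root {x : L} (hx : x ∈ IntermediateField.adjoin K {ϖ})
    (hx1 : w x ≤ 1) : ∃ r : R, w (x - algebraMap R L r) < 1 := by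
  obtain ⟨P, rfl, hP⟩ := h.exists_aeval_root_eq hπ hN hϖ hx
  have hle (i : ℕ) := (h.norm_term_le_norm_aeval hπ hN hϖ hP i).trans hx1
  obtain ⟨r, hr⟩ : P.coeff 0 ∈ (algebraMap R K).range := by
    rw [RingHom.mem_range, ← IsIntegrallyClosed.isIntegral_iff (R := R),
      ← isIntegral_algebraMap_iff (algebraMap K L).injective]
    exact (h.le_one_iff _).1 (by simpa using hle 0)
  refine ⟨r, ?_⟩
  rw [IsScalarTower.algebraMap_apply R K L, hr, aeval_eq_sum_range' hP,
    ← Nat.sub_one_add_one hN, Finset.sum_range_succ']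
  simp only [pow_zero, Algebra.smul_def, mul_one, add_sub_cancel_right]
  refine h.sum_lt one_pos fun i hi => (hle (i + 1)).lt_of_ne ?_
  by_cases hc : P.coeff (i + 1) = 0
  · simp [hc]
  have hiN := Finset.mem_range.1 hi
  simpa using h.norm_term_ne hπ hN hϖ hc one_ne_zero (i := i + 1) (j := 0)
    (by lia) (by lia) (by lia)

end Radical

section Lift

open IsLocalRing

variable [IsGalois K L]

include hN

theorem exists_gal_fixing_root_and_lifting [IsLocalRing (integralClosure R L)]
    (φ : ResidueField (integralClosure R L) ≃ₐ[R] ResidueField (integralClosure R L)) :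
    ∃ g : Gal(L/K), g ϖ = ϖ ∧ ∀ x : integralClosure R L,
      residue _ (g • x) = φ (residue _ x) := by
  let O := integralClosure R L
  let E := IntermediateField.adjoin K {ϖ}
  let H := E.fixingSubgroup
  let : TopologicalSpace O := ⊥
  have : DiscreteTopology O := ⟨rfl⟩
  have : CompactSpace H := isCompact_iff_compactSpace.1
    (InfiniteGalois.fixingSubgroup_isClosed _).isCompact
  have : ContinuousSMul H O := by
    rw [continuousSMul_iff_stabilizer_isOpen]
    intro x
    convert (stabilizer_isOpen_of_isIntegral (K := K) (x : L)).preimage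
      (continuous_subtype_val (p := (· ∈ H)))
    ext g
    simp only [SetLike.mem_coe, MulAction.mem_stabilizer_iff, Set.mem_preimage, Subtype.ext_iff]
    rfl
  have hR (b : O) (hb : ∀ g : H, g • b = b) : ∃ r : R, b - algebraMap R O r ∈ maximalIdeal O := by
    have hbE : (b : L) ∈ E := by
      rw [← InfiniteGalois.fixedField_fixingSubgroup E]
      exact fun g => congr_arg Subtype.val (hb g)
    obtain ⟨r, hr⟩ := h.exists_sub_lt_one_of_mem_adjoin_root hπ hN hϖ hbE ((h.le_one_iff _).2 b.2)
    exact ⟨r, (h.mem_maximalIdeal_iff _).2 hr⟩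
  obtain ⟨g, hg⟩ := exists_forall_mk_smul_eq_of_profinite (G := H) (maximalIdeal O) hR φ
  exact ⟨g, g.2 ⟨ϖ, IntermediateField.mem_adjoin_simple_self K ϖ⟩, hg⟩

theorem exists_inertia_mul_root {ξ : L} (hξ : ξ ^ N = 1) :
    ∃ t : Gal(L/K), t ϖ = ξ * ϖ ∧ IsResiduePow w ⊤ 1 t := by
  have := h.isLocalRing
  have : FaithfulSMul R L := FaithfulSMul.trans R K L
  obtain ⟨σ, hσ⟩ : ∃ σ : Gal(L/K), σ ϖ = ξ * ϖ := by
    have hξϖ : (ξ * ϖ) ^ N = algebraMap R L π := by rw [mul_pow, hξ, one_mul, hϖ]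
    rw [← isConjRoot_iff_exists_algEquiv, isConjRoot_def, h.minpoly_root hπ hN hϖ,
      h.minpoly_root hπ hN hξϖ]
  -- Divide `σ` by an element with the same residual action that fixes `ϖ`.
  obtain ⟨g, hgϖ, hg⟩ := h.exists_gal_fixing_root_and_lifting hπ hN hϖ
    ((ResidueField.mapAlgEquiv'
      (MulSemiringAction.toAlgEquiv R (integralClosure R L) σ)).restrictScalars R)
  refine ⟨σ * g⁻¹, ?_, fun x _ hx => ?_⟩
  · rw [AlgEquiv.mul_apply, show g⁻¹ ϖ = ϖ from (AlgEquiv.symm_apply_eq g).2 hgϖ.symm, hσ]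
  · obtain ⟨z, rfl⟩ := g.surjective x
    rw [h.map_gal] at hx
    rw [AlgEquiv.mul_apply, show g⁻¹ (g z) = z from g.symm_apply_apply z, pow_one]
    let y : integralClosure R L := ⟨z, (h.le_one_iff z).1 hx⟩
    exact (h.residue_eq_residue_iff (σ • y) (g • y)).1 (hg y).symm

theorem exists_frobenius_fixing_root [Finite (ResidueField R)] :
    ∃ s : Gal(L/K), s ϖ = ϖ ∧ IsResiduePow w ⊤ (Nat.card (ResidueField R)) s := by
  have := h.isLocalRing
  have : FaithfulSMul R L := FaithfulSMul.trans R K L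
  have := Fintype.ofFinite (ResidueField R)
  have : Algebra.IsIntegral (ResidueField R) (ResidueField (integralClosure R L)) :=
    Ideal.Quotient.algebra_isIntegral_of_liesOver (maximalIdeal _) (maximalIdeal R)
  obtain ⟨s, hsϖ, hs⟩ := h.exists_gal_fixing_root_and_lifting hπ hN hϖ
    ((FiniteField.frobeniusAlgEquivOfAlgebraic (ResidueField R)
      (ResidueField (integralClosure R L))).restrictScalars R)
  refine ⟨s, hsϖ, fun x _ hx => ?_⟩
  let y : integralClosure R L := ⟨x, (h.le_one_iff x).1 hx⟩
  rw [Nat.card_eq_fintype_card]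
  exact (h.residue_eq_residue_iff (s • y) (y ^ _)).1 (hs y)

end Lift

end IsLocalNorm

section CutOut

variable {K L Γ : Type*} [Field K] [Field L] [Algebra K L] [Group Γ]

/-- The extension of `K` cut out by a homomorphism `ρ : Gal(L/K) →* Γ`, that is, the fixed field of
its kernel. If `Γ` is finite and `ρ` is continuous, it is a finite Galois extension of `K` whose
Galois group is the image of `ρ`. -/
def cutOutField (ρ : Gal(L/K) →* Γ) : IntermediateField K L :=
  IntermediateField.fixedField ρ.ker

variable [TopologicalSpace Γ] [DiscreteTopology Γ] (ρ : Gal(L/K) →ₜ* Γ)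

theorem isOpen_ker : IsOpen (ρ.ker : Set Gal(L/K)) :=
  (isOpen_discrete {1}).preimage ρ.continuous_toFun

variable [IsGalois K L]

theorem fixingSubgroup_cutOutField : (cutOutField (ρ : Gal(L/K) →* Γ)).fixingSubgroup = ρ.ker :=
  InfiniteGalois.fixingSubgroup_fixedField ⟨ρ.ker, Subgroup.isClosed_of_isOpen _ (isOpen_ker ρ)⟩

theorem map_eq_one_of_forall_apply_eq {σ : Gal(L/K)}
    (hσ : ∀ x ∈ cutOutField (ρ : Gal(L/K) →* Γ), σ x = x) : ρ σ = 1 :=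
  (fixingSubgroup_cutOutField ρ).le ((IntermediateField.mem_fixingSubgroup_iff _ _).2 hσ)

theorem isGalois_cutOutField : IsGalois K (cutOutField (ρ : Gal(L/K) →* Γ)) := by
  rw [← InfiniteGalois.normal_iff_isGalois, fixingSubgroup_cutOutField]
  infer_instance

theorem finiteDimensional_cutOutField :
    FiniteDimensional K (cutOutField (ρ : Gal(L/K) →* Γ)) := by
  rw [← InfiniteGalois.isOpen_iff_finite, fixingSubgroup_cutOutField]
  exact isOpen_ker ρ

theorem finrank_cutOutField_dvd_card :
    Module.finrank K (cutOutField (ρ : Gal(L/K) →* Γ)) ∣ Nat.card Γ := by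
  have := isGalois_cutOutField ρ
  have := finiteDimensional_cutOutField ρ
  let H : ClosedSubgroup Gal(L/K) := ⟨ρ.ker, Subgroup.isClosed_of_isOpen _ (isOpen_ker ρ)⟩
  have : H.Normal := ρ.normal_ker
  have hcard : Nat.card Gal(cutOutField (ρ : Gal(L/K) →* Γ)/K) = Nat.card ρ.range :=
    Nat.card_congr ((InfiniteGalois.normalAutEquivQuotient H).symm.trans
      (QuotientGroup.quotientKerEquivRange (ρ : Gal(L/K) →* Γ))).toEquiv
  rw [← IsGalois.card_aut_eq_finrank, hcard]
  exact Subgroup.card_subgroup_dvd_card _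

end CutOut

section FixedRoot

variable {K L : Type*} [Field K] [Field L] [Algebra K L] {w : AbsoluteValue L ℝ}

theorem apply_sub_lt_of_isResiduePow_one {ϖ : L} {E : IntermediateField K L} {σ : Gal(L/K)}
    (hσϖ : σ ϖ = ϖ) (hσ : IsResiduePow w E 1 σ) (hϖE : ϖ ∈ E) {x : L} (hxE : x ∈ E) (hx : x ≠ 0)
    {i : ℤ} (hxi : w x = w ϖ ^ i) : w (σ x - x) < w x := by
  have hy : w (x / ϖ ^ i) = 1 := by
    rw [map_div₀, map_zpow₀, ← hxi, div_self (w.ne_zero hx)]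
  have hlt := hσ _ (div_mem hxE (zpow_mem hϖE i)) hy.le
  rwa [pow_one, map_div₀, map_zpow₀, hσϖ, ← sub_div, map_div₀, map_zpow₀, ← hxi,
    div_lt_one (w.pos hx)] at hlt

theorem sum_pow_apply_sub {N : ℕ} {σ : Gal(L/K)} {x : L} (hx : (σ ^ N) x = x) :
    ∑ i ∈ Finset.range N, (σ ^ i) (σ x - x) = 0 := by
  have htel (i : ℕ) : (σ ^ i) (σ x - x) = (σ ^ (i + 1)) x - (σ ^ i) x := by
    rw [map_sub, pow_succ, AlgEquiv.mul_apply]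
  simp_rw [htel]
  rw [Finset.sum_range_sub (fun i => (σ ^ i) x), hx, pow_zero, AlgEquiv.one_apply, sub_self]

end FixedRoot

namespace IsLocalNorm

variable {R K L : Type*} [CommRing R] [Field K] [Field L] [Algebra K L] [Algebra R L]
    {w : AbsoluteValue L ℝ} (h : IsLocalNorm R K L w)
include h

theorem norm_algebraMap_algebraNorm [IsGalois K L] (F : IntermediateField K L) [IsGalois K F]
    [FiniteDimensional K F] (x : F) :
    w (algebraMap K L (Algebra.norm K x)) = w x ^ Module.finrank K F := by
  have hconj (σ : Gal(F/K)) : w (σ x : F) = w x := by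
    obtain ⟨τ, rfl⟩ := AlgEquiv.restrictNormalHom_surjective (F := K) (K₁ := F) L σ
    rw [← h.map_gal τ x]
    exact congr_arg w (AlgEquiv.restrictNormal_commutes τ F x)
  rw [IsScalarTower.algebraMap_apply K F L, Algebra.norm_eq_prod_automorphisms]
  simp [hconj, ← IsGalois.card_aut_eq_finrank, Nat.card_eq_fintype_card]

section Tame

variable {N : ℕ} {ϖ : L}

theorem exists_zpow_of_finrank_dvd [IsDomain R] [IsDiscreteValuationRing R] [Algebra R K]
    [IsFractionRing R K] [IsScalarTower R K L] [IsGalois K L] {π : R} (hπ : Irreducible π)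
    (hN : N ≠ 0) (hϖ : ϖ ^ N = algebraMap R L π) {F : IntermediateField K L} [IsGalois K F]
    [FiniteDimensional K F] (hF : Module.finrank K F ∣ N) {x : L} (hxF : x ∈ F) (hx : x ≠ 0) :
    ∃ i : ℤ, w x = w ϖ ^ i := by
  obtain ⟨e, he⟩ := hF
  have hnorm : Algebra.norm K (⟨x, hxF⟩ : F) ≠ 0 :=
    Algebra.norm_ne_zero_iff.2 fun h0 => hx (congr_arg Subtype.val h0)
  obtain ⟨m, hm⟩ := h.exists_zpow_root hπ hϖ hnorm
  rw [h.norm_algebraMap_algebraNorm] at hm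
  refine ⟨m * e, (pow_left_inj₀ (w.nonneg x) (zpow_nonneg (w.nonneg ϖ) _) hN).1 ?_⟩
  calc w x ^ N = (w ϖ ^ (N * m : ℤ)) ^ e := by rw [← hm, ← pow_mul, ← he]
    _ = (w ϖ ^ (m * e : ℤ)) ^ N := by
      rw [← zpow_natCast, ← zpow_natCast, ← zpow_mul, ← zpow_mul]
      ring_nf

theorem apply_eq_self_of_pow_apply_eq_self (hN : w (N : L) = 1) {σ : Gal(L/K)} {x : L}
    (hx : (σ ^ N) x = x)
    (hlt : σ x - x ≠ 0 → w (σ (σ x - x) - (σ x - x)) < w (σ x - x)) : σ x = x := by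
  -- If `u = σ x - x` is nonzero, the `σ ^ i u` with `i < N` sum to zero, while each of them is
  -- close to `u`, so that their sum is close to `N u`.
  rw [← sub_eq_zero]
  by_contra hu
  have hsum := sum_pow_apply_sub hx
  set u := σ x - x
  have hpow (i : ℕ) : w ((σ ^ i) u - u) < w u := by
    induction i with
    | zero => simpa using w.pos hu
    | succ i ih =>
      rw [pow_succ', AlgEquiv.mul_apply, ← sub_add_sub_cancel _ (σ u), ← map_sub]
      exact h.add_lt (by rwa [h.map_gal]) (hlt hu)
  have hlt_sum : w (∑ i ∈ Finset.range N, ((σ ^ i) u - u)) < w u :=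
    h.sum_lt (w.pos hu) fun i _ => hpow i
  rw [Finset.sum_sub_distrib, hsum, zero_sub, w.map_neg, Finset.sum_const, Finset.card_range,
    nsmul_eq_mul, map_mul, hN, one_mul] at hlt_sum
  exact lt_irrefl _ hlt_sum

theorem map_eq_one_of_apply_root_eq [IsDomain R] [IsDiscreteValuationRing R] [Algebra R K]
    [IsFractionRing R K] [IsScalarTower R K L] [IsGalois K L] {Γ : Type*} [Group Γ]
    [TopologicalSpace Γ] [DiscreteTopology Γ] (hN : w (N : L) = 1) (hΓ : Nat.card Γ ∣ N) {π : R}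
    (hπ : Irreducible π) (hϖ : ϖ ^ N = algebraMap R L π) (ρ : Gal(L/K) →ₜ* Γ) {σ : Gal(L/K)}
    (hσϖ : σ ϖ = ϖ)
    (hσ : IsResiduePow w (cutOutField (ρ : Gal(L/K) →* Γ) ⊔ IntermediateField.adjoin K {ϖ}) 1 σ) :
    ρ σ = 1 := by
  have hN0 : N ≠ 0 := by rintro rfl; simp at hN
  let F := cutOutField (ρ : Gal(L/K) →* Γ)
  have : IsGalois K F := isGalois_cutOutField ρ
  have : FiniteDimensional K F := finiteDimensional_cutOutField ρ
  refine map_eq_one_of_forall_apply_eq ρ fun x hx => h.apply_eq_self_of_pow_apply_eq_self hN ?_ ?_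
  · refine (IntermediateField.mem_fixedField_iff _ _).1 hx (σ ^ N) ?_
    rw [MonoidHom.mem_ker, map_pow,
      orderOf_dvd_iff_pow_eq_one.1 ((orderOf_dvd_natCard _).trans hΓ)]
  · intro hu
    have hσF : F.map σ.toAlgHom ≤ F :=
      IntermediateField.normal_iff_forall_map_le'.1 inferInstance σ
    have huF : σ x - x ∈ F := sub_mem (hσF ⟨x, hx, rfl⟩) hx
    obtain ⟨i, hi⟩ := h.exists_zpow_of_finrank_dvd hπ hN0 hϖ
      ((finrank_cutOutField_dvd_card ρ).trans hΓ) huF hu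
    exact apply_sub_lt_of_isResiduePow_one hσϖ hσ
      (le_sup_right (a := F) (IntermediateField.mem_adjoin_simple_self K ϖ))
      (le_sup_left (a := F) huF) hu hi

end Tame

end IsLocalNorm

theorem modEq_of_pow_modEq_pow_sub_one {q N j j' : ℕ} (hq : 2 ≤ q)
    (hj : q ^ j ≡ q ^ j' [MOD q ^ N - 1]) : j ≡ j' [MOD N] := by
  have hpos (k : ℕ) : 1 ≤ q ^ k := Nat.one_le_pow _ _ (by lia)
  have hsub : q ^ j - 1 ≡ q ^ j' - 1 [MOD q ^ N - 1] :=
    Nat.ModEq.add_right_cancel' 1 <| by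
      rwa [Nat.sub_add_cancel (hpos j), Nat.sub_add_cancel (hpos j')]
  rw [Nat.ModEq, Nat.pow_sub_one_mod_pow_sub_one, Nat.pow_sub_one_mod_pow_sub_one] at hsub
  exact Nat.pow_right_injective hq ((tsub_left_inj (hpos _) (hpos _)).1 hsub)

theorem pow_mul_pow_eq_of_conj_eq_pow {Γ : Type*} [Group Γ] {q : ℕ} {x y : Γ}
    (hxy : x * y * x⁻¹ = y ^ q) (i j : ℕ) : x ^ j * y ^ i = y ^ (q ^ j * i) * x ^ j := by
  have hsemi (i : ℕ) : SemiconjBy x (y ^ i) (y ^ (q * i)) := by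
    rw [pow_mul]
    exact SemiconjBy.pow_right (mul_inv_eq_iff_eq_mul.1 hxy) i
  induction j generalizing i with
  | zero => simp
  | succ j ih =>
    rw [pow_succ x, mul_assoc, (hsemi i).eq, ← mul_assoc, ih, mul_assoc, pow_succ q, mul_assoc]

/-- Generators `s`, `t` of the tame quotient of `Gal(L/K)`, seen through the action on a single
`N`-th root `ϖ` of a uniformizer, where `N` is prime to the residue characteristic: `s` is a
Frobenius lift fixing `ϖ`, and `t` lies in the inertia group and multiplies `ϖ` by the primitive
`N`-th root of unity `ξ`. -/
structure IsTameFrame (R K : Type*) {L : Type*} [CommRing R] [IsLocalRing R] [Field K] [Field L]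
    [Algebra K L] [Algebra R L] (w : AbsoluteValue L ℝ) (N q : ℕ) (ϖ ξ : L) (s t : Gal(L/K)) : Prop
    extends IsLocalNorm R K L w where
  norm_natCast : w (N : L) = 1
  card_residueField : Nat.card (IsLocalRing.ResidueField R) = q
  exists_irreducible : ∃ π : R, Irreducible π ∧ ϖ ^ N = algebraMap R L π
  isPrimitiveRoot : IsPrimitiveRoot ξ N
  frob_root : s ϖ = ϖ
  frob : IsResiduePow w ⊤ q s
  inertia_root : t ϖ = ξ * ϖ
  inertia : IsResiduePow w ⊤ 1 t

/-- The action of `σ` on an `N`-th root `ϖ` of a uniformizer and on the roots of unity `ξ` (of order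
`N`) and `ζ` is that of `t ^ i * s ^ j` for a tame frame `(s, t)`. -/
structure HasTameExponents {K L : Type*} [Field K] [Field L] [Algebra K L] (q : ℕ) (ϖ ξ ζ : L)
    (σ : Gal(L/K)) (i j : ℕ) : Prop where
  root : σ ϖ = ξ ^ i * ϖ
  apply_left : σ ξ = ξ ^ q ^ j
  apply_right : σ ζ = ζ ^ q ^ j

theorem HasTameExponents.mul {K L : Type*} [Field K] [Field L] [Algebra K L] {q : ℕ} {ϖ ξ ζ : L}
    {σ τ : Gal(L/K)} {i j i' j' : ℕ} (hσ : HasTameExponents q ϖ ξ ζ σ i j)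
    (hτ : HasTameExponents q ϖ ξ ζ τ i' j') :
    HasTameExponents q ϖ ξ ζ (σ * τ) (i + q ^ j * i') (j + j') where
  root := by
    rw [AlgEquiv.mul_apply, hτ.root, map_mul, map_pow, hσ.apply_left, hσ.root]
    ring
  apply_left := by
    rw [AlgEquiv.mul_apply, hτ.apply_left, map_pow, hσ.apply_left, ← pow_mul, ← pow_add]
  apply_right := by
    rw [AlgEquiv.mul_apply, hτ.apply_right, map_pow, hσ.apply_right, ← pow_mul, ← pow_add]

namespace IsTameFrame

variable {R K L : Type*} [CommRing R] [IsDomain R] [IsDiscreteValuationRing R] [Field K] [Field L]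
    [Algebra K L] [Algebra R L] {w : AbsoluteValue L ℝ} {N q : ℕ} {ϖ ξ : L} {s t : Gal(L/K)}
    (h : IsTameFrame R K w N q ϖ ξ s t)
include h

theorem ne_zero : N ≠ 0 := by
  rintro rfl
  simpa using h.norm_natCast

theorem root_ne_zero [FaithfulSMul R L] : ϖ ≠ 0 := by
  obtain ⟨π, hπ, hϖ⟩ := h.exists_irreducible
  exact ne_zero_of_pow_eq_algebraMap hπ.ne_zero h.ne_zero hϖ

theorem two_le_card [Finite (IsLocalRing.ResidueField R)] : 2 ≤ q := by
  rw [← h.card_residueField]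
  exact Finite.one_lt_card

theorem exists_apply_root_eq [FaithfulSMul R L] [Algebra R K] [IsScalarTower R K L]
    (σ : Gal(L/K)) : ∃ i : ℕ, σ ϖ = ξ ^ i * ϖ := by
  have : NeZero N := ⟨h.ne_zero⟩
  obtain ⟨π, -, hϖ⟩ := h.exists_irreducible
  obtain ⟨i, -, hi⟩ := h.isPrimitiveRoot.eq_pow_of_pow_eq_one (ξ := σ ϖ / ϖ) (by
    rw [div_pow, ← map_pow, hϖ, IsScalarTower.algebraMap_apply R K L, AlgEquiv.commutes,
      ← IsScalarTower.algebraMap_apply R K L, ← hϖ, div_self (pow_ne_zero _ h.root_ne_zero)])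
  exact ⟨i, by rw [hi, div_mul_cancel₀ _ h.root_ne_zero]⟩

theorem frob_apply {M : ℕ} (hM : w (M : L) = 1) {ζ : L} (hζ : ζ ^ M = 1) : s ζ = ζ ^ q :=
  h.apply_eq_pow_of_isResiduePow hM h.frob trivial hζ

theorem inertia_apply {M : ℕ} (hM : w (M : L) = 1) {ζ : L} (hζ : ζ ^ M = 1) : t ζ = ζ := by
  rw [h.apply_eq_pow_of_isResiduePow hM h.inertia trivial hζ, pow_one]

theorem inertia_pow_mul_frob_pow_root (i j : ℕ) : (t ^ i * s ^ j) ϖ = ξ ^ i * ϖ := by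
  have hs : (s ^ j) ϖ = ϖ := by
    induction j with
    | zero => rfl
    | succ j ih => rw [pow_succ, AlgEquiv.mul_apply, h.frob_root, ih]
  rw [AlgEquiv.mul_apply, hs]
  induction i with
  | zero => simp
  | succ i ih =>
    rw [pow_succ', AlgEquiv.mul_apply, ih, map_mul, map_pow, h.inertia_root,
      h.inertia_apply h.norm_natCast h.isPrimitiveRoot.pow_eq_one]
    ring

theorem isResiduePow_inertia_pow_mul_frob_pow (i j : ℕ) :
    IsResiduePow w ⊤ (q ^ j) (t ^ i * s ^ j) := by
  simpa using h.isResiduePow_mul (h.isResiduePow_pow h.inertia i) (h.isResiduePow_pow h.frob j)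

theorem exists_hasTameExponents [Algebra R K] [IsFractionRing R K] [IsScalarTower R K L]
    [IsGalois K L] [Finite (IsLocalRing.ResidueField R)] {M : ℕ} (hM : w (M : L) = 1) {ζ : L}
    (hζ : ζ ^ M = 1) (σ : Gal(L/K)) : ∃ i j, HasTameExponents q ϖ ξ ζ σ i j := by
  have : FaithfulSMul R L := FaithfulSMul.trans R K L
  let E := IntermediateField.adjoin K {ξ, ζ}
  have : FiniteDimensional K E := IntermediateField.finiteDimensional_adjoin fun x _ =>
    Algebra.IsIntegral.isIntegral x
  obtain ⟨i, hi⟩ := h.exists_apply_root_eq σ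
  obtain ⟨j, hj⟩ := h.exists_isResiduePow E σ
  rw [h.card_residueField] at hj
  exact ⟨i, j, hi,
    h.apply_eq_pow_of_isResiduePow h.norm_natCast hj
      (IntermediateField.subset_adjoin K _ (Set.mem_insert ξ {ζ})) h.isPrimitiveRoot.pow_eq_one,
    h.apply_eq_pow_of_isResiduePow hM hj
      (IntermediateField.subset_adjoin K _ (Set.mem_insert_of_mem ξ rfl)) hζ⟩

theorem hasTameExponents_frob {M : ℕ} (hM : w (M : L) = 1) {ζ : L} (hζ : ζ ^ M = 1) :
    HasTameExponents q ϖ ξ ζ s 0 1 where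
  root := by rw [h.frob_root, pow_zero, one_mul]
  apply_left := by rw [h.frob_apply h.norm_natCast h.isPrimitiveRoot.pow_eq_one, pow_one]
  apply_right := by rw [h.frob_apply hM hζ, pow_one]

theorem hasTameExponents_inertia {M : ℕ} (hM : w (M : L) = 1) {ζ : L} (hζ : ζ ^ M = 1) :
    HasTameExponents q ϖ ξ ζ t 1 0 where
  root := by rw [h.inertia_root, pow_one]
  apply_left := by
    rw [h.inertia_apply h.norm_natCast h.isPrimitiveRoot.pow_eq_one, pow_zero, pow_one]
  apply_right := by rw [h.inertia_apply hM hζ, pow_zero, pow_one]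

section Hom

variable {Γ : Type*} [Group Γ] (hΓ : Nat.card Γ ∣ N)
include hΓ

theorem pow_mul_pow_eq_of_hasTameExponents [FaithfulSMul R L]
    [Finite (IsLocalRing.ResidueField R)] {ζ : L} (hζ : IsPrimitiveRoot ζ (q ^ N - 1)) (x y : Γ)
    {σ : Gal(L/K)} {i j i' j' : ℕ} (hσ : HasTameExponents q ϖ ξ ζ σ i j)
    (hσ' : HasTameExponents q ϖ ξ ζ σ i' j') : y ^ i * x ^ j = y ^ i' * x ^ j' := by
  have hfin {M : ℕ} (hM : M ≠ 0) {z : L} (hz : IsPrimitiveRoot z M) {a b : ℕ} :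
      z ^ a = z ^ b ↔ a ≡ b [MOD M] := by
    rw [(hz.isOfFinOrder hM).pow_eq_pow_iff_modEq, ← hz.eq_orderOf]
  have hi : i ≡ i' [MOD N] := (hfin h.ne_zero h.isPrimitiveRoot).1 <|
    mul_right_cancel₀ h.root_ne_zero (hσ.root.symm.trans hσ'.root)
  have hM : q ^ N - 1 ≠ 0 := by
    have := Nat.one_lt_pow h.ne_zero h.two_le_card
    lia
  have hj : j ≡ j' [MOD N] := modEq_of_pow_modEq_pow_sub_one h.two_le_card <|
    (hfin hM hζ).1 (hσ.apply_right.symm.trans hσ'.apply_right)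
  rw [pow_eq_pow_iff_modEq.2 (hi.of_dvd ((orderOf_dvd_natCard y).trans hΓ)),
    pow_eq_pow_iff_modEq.2 (hj.of_dvd ((orderOf_dvd_natCard x).trans hΓ))]

variable [TopologicalSpace Γ] [DiscreteTopology Γ] [Algebra R K] [IsFractionRing R K]
    [IsScalarTower R K L] [IsGalois K L]

theorem map_eq_pow_mul_pow (ρ : Gal(L/K) →ₜ* Γ) {σ : Gal(L/K)} {i j : ℕ} (hσϖ : σ ϖ = ξ ^ i * ϖ)
    (hσ : IsResiduePow w (cutOutField (ρ : Gal(L/K) →* Γ) ⊔ IntermediateField.adjoin K {ϖ})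
      (q ^ j) σ) : ρ σ = ρ t ^ i * ρ s ^ j := by
  obtain ⟨π, hπ, hϖ⟩ := h.exists_irreducible
  have hone : ρ ((t ^ i * s ^ j)⁻¹ * σ) = 1 := by
    refine h.map_eq_one_of_apply_root_eq h.norm_natCast hΓ hπ hϖ ρ ?_
      (h.isResiduePow_inv_mul (h.isResiduePow_inertia_pow_mul_frob_pow i j) hσ)
    rw [AlgEquiv.mul_apply, hσϖ, ← h.inertia_pow_mul_frob_pow_root i j, ← AlgEquiv.mul_apply,
      inv_mul_cancel, AlgEquiv.one_apply]
  rw [map_mul, map_inv, inv_mul_eq_one] at hone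
  rw [← hone, map_mul, map_pow, map_pow]

theorem map_frob_conj (ρ : Gal(L/K) →ₜ* Γ) : ρ s * ρ t * (ρ s)⁻¹ = ρ t ^ q := by
  rw [mul_inv_eq_iff_eq_mul, ← map_mul, ← pow_one (ρ s)]
  refine h.map_eq_pow_mul_pow hΓ ρ ?_ ?_
  · rw [AlgEquiv.mul_apply, h.inertia_root, map_mul, h.frob_root,
      h.frob_apply h.norm_natCast h.isPrimitiveRoot.pow_eq_one]
  · intro x _
    simpa using h.isResiduePow_mul h.frob h.inertia x trivial

theorem map_inertia (ρ : Gal(L/K) →ₜ* Γ) :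
    ((Ring.jacobson (integralClosure R L)).inertia Gal(L/K)).map (ρ : Gal(L/K) →* Γ) =
      Subgroup.zpowers (ρ t) := by
  have : FaithfulSMul R L := FaithfulSMul.trans R K L
  refine le_antisymm ?_ (Subgroup.zpowers_le.2 ⟨t, h.mem_inertia_iff.2 h.inertia, rfl⟩)
  rintro _ ⟨σ, hσ, rfl⟩
  obtain ⟨i, hi⟩ := h.exists_apply_root_eq σ
  have hσ1 := h.map_eq_pow_mul_pow hΓ ρ (j := 0) hi fun x _ => h.mem_inertia_iff.1 hσ x trivial
  exact ⟨i, by simpa using hσ1.symm⟩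

theorem hom_ext [Finite (IsLocalRing.ResidueField R)] {ρ ρ' : Gal(L/K) →ₜ* Γ}
    (hs : ρ s = ρ' s) (ht : ρ t = ρ' t) : ρ = ρ' := by
  ext σ
  have : FaithfulSMul R L := FaithfulSMul.trans R K L
  let F := cutOutField (ρ : Gal(L/K) →* Γ) ⊔ IntermediateField.adjoin K {ϖ}
  let F' := cutOutField (ρ' : Gal(L/K) →* Γ) ⊔ IntermediateField.adjoin K {ϖ}
  have : FiniteDimensional K (IntermediateField.adjoin K {ϖ}) :=
    IntermediateField.adjoin.finiteDimensional (Algebra.IsIntegral.isIntegral ϖ)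
  have := finiteDimensional_cutOutField ρ
  have := finiteDimensional_cutOutField ρ'
  obtain ⟨i, hi⟩ := h.exists_apply_root_eq σ
  obtain ⟨j, hj⟩ := h.exists_isResiduePow (F ⊔ F') σ
  rw [h.card_residueField] at hj
  rw [h.map_eq_pow_mul_pow hΓ ρ hi fun x hx => hj x (le_sup_left (a := F) hx),
    h.map_eq_pow_mul_pow hΓ ρ' hi fun x hx => hj x (le_sup_right (a := F) hx), hs, ht]

theorem exists_hom [Finite (IsLocalRing.ResidueField R)] {ζ : L}
    (hζ : IsPrimitiveRoot ζ (q ^ N - 1)) (hM : w ((q ^ N - 1 : ℕ) : L) = 1) {x y : Γ}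
    (hxy : x * y * x⁻¹ = y ^ q) : ∃ ρ : Gal(L/K) →ₜ* Γ, ρ s = x ∧ ρ t = y := by
  have : FaithfulSMul R L := FaithfulSMul.trans R K L
  choose a b hab using h.exists_hasTameExponents hM hζ.pow_eq_one
  have hval {σ : Gal(L/K)} {i j : ℕ} (hσ : HasTameExponents q ϖ ξ ζ σ i j) :
      y ^ a σ * x ^ b σ = y ^ i * x ^ j :=
    h.pow_mul_pow_eq_of_hasTameExponents hΓ hζ x y (hab σ) hσ
  let ρ : Gal(L/K) →* Γ := MonoidHom.mk' (fun σ => y ^ a σ * x ^ b σ) fun σ τ => by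
    rw [hval ((hab σ).mul (hab τ)), pow_add, pow_add, mul_assoc (y ^ a σ), ← mul_assoc _ (x ^ b σ),
      ← pow_mul_pow_eq_of_conj_eq_pow hxy]
    simp only [mul_assoc]
  have hρ : Continuous ρ := by
    refine continuous_of_continuousAt_one ρ ?_
    rw [ContinuousAt, map_one, nhds_discrete Γ, Filter.tendsto_pure]
    have hstab (z : L) := (stabilizer_isOpen_of_isIntegral (K := K) z).mem_nhds (one_mem _)
    filter_upwards [hstab ϖ, hstab ξ, hstab ζ] with σ hσϖ hσξ hσζ
    have hσ : HasTameExponents q ϖ ξ ζ σ 0 0 :=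
      ⟨by simpa using hσϖ, by simpa using hσξ, by simpa using hσζ⟩
    exact (hval hσ).trans (by simp)
  exact ⟨⟨ρ, hρ⟩, (hval (h.hasTameExponents_frob hM hζ.pow_eq_one)).trans (by simp),
    (hval (h.hasTameExponents_inertia hM hζ.pow_eq_one)).trans (by simp)⟩

end Hom

end IsTameFrame

section TameEquiv

variable {R K L : Type*} [CommRing R] [IsDomain R] [IsDiscreteValuationRing R]
    [Finite (IsLocalRing.ResidueField R)] [Field K] [Field L] [Algebra R K] [Algebra K L]
    [Algebra R L] [IsFractionRing R K] [IsScalarTower R K L] [IsGalois K L] [IsSepClosed L]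
    {w : AbsoluteValue L ℝ}

theorem IsLocalNorm.exists_isPrimitiveRoot (h : IsLocalNorm R K L w) {n : ℕ}
    (hn : (Nat.card (IsLocalRing.ResidueField R)).Coprime n) :
    w (n : L) = 1 ∧ ∃ ξ : L, IsPrimitiveRoot ξ n := by
  have : FaithfulSMul R L := FaithfulSMul.trans R K L
  have hw : w (n : L) = 1 := h.natCast_eq_one hn
  have : NeZero (n : L) := ⟨fun h0 => by simp [h0] at hw⟩
  exact ⟨hw, HasEnoughRootsOfUnity.exists_primitiveRoot L n⟩

theorem IsLocalNorm.exists_isTameFrame (h : IsLocalNorm R K L w) {N : ℕ}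
    (hN : (Nat.card (IsLocalRing.ResidueField R)).Coprime N) :
    ∃ (ϖ ξ : L) (s t : Gal(L/K)),
      IsTameFrame R K w N (Nat.card (IsLocalRing.ResidueField R)) ϖ ξ s t := by
  obtain ⟨hw, ξ, hξ⟩ := h.exists_isPrimitiveRoot hN
  have hN0 : N ≠ 0 := by rintro rfl; simp at hw
  have : NeZero (N : L) := ⟨fun h0 => by simp [h0] at hw⟩
  obtain ⟨π, hπ⟩ := IsDiscreteValuationRing.exists_irreducible R
  obtain ⟨ϖ, hϖ⟩ := IsSepClosed.exists_pow_nat_eq (algebraMap R L π) N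
  obtain ⟨s, hsϖ, hs⟩ := h.exists_frobenius_fixing_root hπ hN0 hϖ
  obtain ⟨t, htϖ, ht⟩ := h.exists_inertia_mul_root hπ hN0 hϖ hξ.pow_eq_one
  exact ⟨ϖ, ξ, s, t, h, hw, rfl, ⟨π, hπ, hϖ⟩, hξ, hsϖ, hs, htϖ, ht⟩

theorem IsLocalNorm.exists_tame_equiv (h : IsLocalNorm R K L w) (Γ : Type*) [Group Γ] [Finite Γ]
    [TopologicalSpace Γ] [DiscreteTopology Γ]
    (hΓ : (Nat.card (IsLocalRing.ResidueField R)).Coprime (Nat.card Γ)) :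
    ∃ e : (Gal(L/K) →ₜ* Γ) ≃
        {p : Γ × Γ // p.1 * p.2 * p.1⁻¹ = p.2 ^ Nat.card (IsLocalRing.ResidueField R)},
      ∀ ρ : Gal(L/K) →ₜ* Γ,
        ((Ring.jacobson (integralClosure R L)).inertia Gal(L/K)).map (ρ : Gal(L/K) →* Γ) =
          Subgroup.zpowers (e ρ).1.2 := by
  obtain ⟨ϖ, ξ, s, t, hst⟩ := h.exists_isTameFrame hΓ
  set q := Nat.card (IsLocalRing.ResidueField R)
  have hcop : q.Coprime (q ^ Nat.card Γ - 1) := by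
    refine Nat.Coprime.coprime_dvd_left (dvd_pow_self q (Nat.card_pos (α := Γ)).ne') ?_
    exact (Nat.coprime_self_sub_right <| Nat.one_le_pow _ q Nat.card_pos).2
      (Nat.coprime_one_right _)
  obtain ⟨hM, ζ, hζ⟩ := h.exists_isPrimitiveRoot hcop
  let e : (Gal(L/K) →ₜ* Γ) → {p : Γ × Γ // p.1 * p.2 * p.1⁻¹ = p.2 ^ q} := fun ρ =>
    ⟨(ρ s, ρ t), hst.map_frob_conj dvd_rfl ρ⟩
  have he : Function.Bijective e := by
    refine ⟨fun ρ ρ' hρ => ?_, fun ⟨⟨x, y⟩, hxy⟩ => ?_⟩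
    · obtain ⟨hs, ht⟩ := Prod.ext_iff.1 (congr_arg Subtype.val hρ)
      exact hst.hom_ext dvd_rfl hs ht
    · obtain ⟨ρ, hρs, hρt⟩ := hst.exists_hom dvd_rfl hζ hM hxy
      exact ⟨ρ, Subtype.ext (Prod.ext hρs hρt)⟩
  exact ⟨Equiv.ofBijective e he, fun ρ => hst.map_inertia dvd_rfl ρ⟩

end TameEquiv

section TracePow

variable {k V : Type*} [Field k] [AddCommGroup V] [Module k V] {f : Module.End k V}

theorem pow_apply_of_mem_eigenspace {μ : k} {x : V} (hx : x ∈ f.eigenspace μ) (a : ℕ) :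
    (f ^ a) x = μ ^ a • x := by
  induction a with
  | zero => simp
  | succ a ih =>
    rw [pow_succ', Module.End.mul_apply, ih, map_smul, Module.End.mem_eigenspace_iff.1 hx,
      smul_smul, ← pow_succ]

theorem pow_eq_one_of_eigenspace_ne_bot {n : ℕ} (hf : f ^ n = 1) {μ : k}
    (hμ : f.eigenspace μ ≠ ⊥) : μ ^ n = 1 := by
  obtain ⟨x, hx, hx0⟩ := (Submodule.ne_bot_iff _).1 hμ
  have hpow := pow_apply_of_mem_eigenspace hx n
  rw [hf, Module.End.one_apply] at hpow
  exact smul_left_injective k hx0 (by simpa using hpow.symm)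

variable [FiniteDimensional k V]

theorem isInternal_eigenspace_of_pow_eq_one [IsAlgClosed k] [DecidableEq k] {n : ℕ}
    (hn : (n : k) ≠ 0) (hf : f ^ n = 1) :
    DirectSum.IsInternal f.eigenspace := by
  have hss : f.IsSemisimple := by
    refine Module.End.isSemisimple_of_squarefree_aeval_eq_zero (p := X ^ n - 1) ?_ (by simp [hf])
    exact (separable_X_pow_sub_C (1 : k) hn one_ne_zero).squarefree
  exact DirectSum.isInternal_submodule_of_iSupIndep_of_iSup_eq_top f.eigenspaces_iSupIndep
    hss.iSup_eigenspace_eq_top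

theorem trace_pow_eq_sum_finrank_mul_pow [DecidableEq k] (hf : DirectSum.IsInternal f.eigenspace)
    (hfin : {μ | f.eigenspace μ ≠ ⊥}.Finite) (a : ℕ) :
    LinearMap.trace k V (f ^ a) =
      ∑ μ ∈ hfin.toFinset, (Module.finrank k (f.eigenspace μ) : k) * μ ^ a := by
  have hmaps (μ : k) : Set.MapsTo (f ^ a) (f.eigenspace μ) (f.eigenspace μ) :=
    f.mapsTo_genEigenspace_of_comm (Commute.pow_self f a).symm μ 1
  rw [LinearMap.trace_eq_sum_trace_restrict' hf hfin hmaps]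
  refine Finset.sum_congr rfl fun μ _ => ?_
  have hrestrict : (f ^ a).restrict (hmaps μ) = μ ^ a • LinearMap.id := by
    ext ⟨x, hx⟩
    exact pow_apply_of_mem_eigenspace hx a
  rw [hrestrict, map_smul, LinearMap.trace_id, smul_eq_mul, mul_comm]

theorem exists_polynomial_trace_pow [IsAlgClosed k] [CharZero k] {n : ℕ} (hn : n ≠ 0)
    (hf : f ^ n = 1) {ζ : k} (hζ : IsPrimitiveRoot ζ n) :
    ∃ P : ℚ[X], ∀ a : ℕ, LinearMap.trace k V (f ^ a) = aeval (ζ ^ a) P := by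
  classical
  have : NeZero n := ⟨hn⟩
  have hfin : {μ | f.eigenspace μ ≠ ⊥}.Finite :=
    WellFoundedGT.finite_ne_bot_of_iSupIndep f.eigenspaces_iSupIndep
  have hpow (μ : k) : ∃ l : ℕ, f.eigenspace μ ≠ ⊥ → ζ ^ l = μ := by
    by_cases hμ : f.eigenspace μ = ⊥
    · exact ⟨0, fun h => absurd hμ h⟩
    · obtain ⟨l, -, hl⟩ := hζ.eq_pow_of_pow_eq_one (pow_eq_one_of_eigenspace_ne_bot hf hμ)
      exact ⟨l, fun _ => hl⟩
  choose l hl using hpow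
  refine ⟨∑ μ ∈ hfin.toFinset, (Module.finrank k (f.eigenspace μ) : ℚ[X]) * X ^ l μ, fun a => ?_⟩
  rw [trace_pow_eq_sum_finrank_mul_pow
    (isInternal_eigenspace_of_pow_eq_one (Nat.cast_ne_zero.2 hn) hf) hfin, map_sum]
  refine Finset.sum_congr rfl fun μ hμ => ?_
  rw [map_mul, map_natCast, map_pow, aeval_X, pow_right_comm, hl μ (by simpa using hμ)]

end TracePow

section RationalValues

variable {k : Type*} [Field k] [CharZero k]

theorem aeval_pow_eq_of_aeval_eq_rat {n : ℕ} [NeZero n] {ζ : k} (hζ : IsPrimitiveRoot ζ n)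
    {P : ℚ[X]} {r : ℚ} (hr : aeval ζ P = r) {a : ℕ} (ha : a.Coprime n) : aeval (ζ ^ a) P = r := by
  have hdvd : minpoly ℚ (ζ ^ a) ∣ P - C r := by
    rw [← cyclotomic_eq_minpoly_rat (hζ.pow_of_coprime a ha) (NeZero.pos n),
      cyclotomic_eq_minpoly_rat hζ (NeZero.pos n)]
    exact minpoly.dvd ℚ ζ (by simp [hr])
  simpa [sub_eq_zero] using aeval_eq_zero_of_dvd_aeval_eq_zero hdvd (minpoly.aeval ℚ (ζ ^ a))

theorem exists_rat_aeval_eq_iff {n : ℕ} [NeZero n] {ζ : k} (hζ : IsPrimitiveRoot ζ n) (P : ℚ[X]) :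
    (∃ r : ℚ, aeval ζ P = r) ↔ ∀ a : ℕ, a.Coprime n → aeval (ζ ^ a) P = aeval ζ P := by
  refine ⟨fun ⟨r, hr⟩ a ha => by rw [aeval_pow_eq_of_aeval_eq_rat hζ hr ha, hr], fun hP => ?_⟩
  let F := IntermediateField.adjoin ℚ {ζ}
  have : IsCyclotomicExtension {n} ℚ F := by
    change IsCyclotomicExtension {n} ℚ F.toSubalgebra
    rw [IntermediateField.adjoin_simple_toSubalgebra_of_isAlgebraic
      (hζ.isIntegral (NeZero.pos n)).tower_top.isAlgebraic]
    exact hζ.adjoin_isCyclotomicExtension ℚ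
  have : IsGalois ℚ F := IsCyclotomicExtension.isGalois {n} ℚ F
  have : FiniteDimensional ℚ F := IsCyclotomicExtension.finiteDimensional {n} ℚ F
  let ζF : F := IntermediateField.AdjoinSimple.gen ℚ ζ
  have hζF : IsPrimitiveRoot ζF n := IsPrimitiveRoot.coe_submonoidClass_iff.1 hζ
  have haeval (z : F) : ((aeval z P : F) : k) = aeval (z : k) P :=
    (aeval_algebraMap_apply k z P).symm
  have hfixed (σ : Gal(F/ℚ)) : σ (aeval ζF P) = aeval ζF P := by
    obtain ⟨a, -, ha, hσ⟩ := hζF.isPrimitiveRoot_iff.1 (hζF.map_of_injective σ.injective)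
    rw [← aeval_algHom_apply, ← hσ]
    exact Subtype.ext <| (haeval _).trans <| (hP a ha).trans (haeval ζF).symm
  obtain ⟨r, hr⟩ := (IsGalois.mem_range_algebraMap_iff_fixed _).2 hfixed
  exact ⟨r, (haeval ζF).symm.trans (by simpa using congr_arg (algebraMap F k) hr.symm)⟩

theorem exists_rat_character_iff [IsAlgClosed k] {Γ V : Type*} [Group Γ] [Finite Γ]
    [AddCommGroup V] [Module k V] [FiniteDimensional k V] (π : Representation k Γ V) (g : Γ) :
    (∃ r : ℚ, π.character g = r) ↔
      ∀ a : ℕ, a.Coprime (Nat.card Γ) → π.character (g ^ a) = π.character g := by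
  obtain ⟨ζ, hζ⟩ := HasEnoughRootsOfUnity.exists_primitiveRoot k (Nat.card Γ)
  obtain ⟨P, hP⟩ := exists_polynomial_trace_pow (f := π g) Nat.card_pos.ne'
    (by rw [← map_pow, pow_card_eq_one', map_one]) hζ
  have hchar (a : ℕ) : π.character (g ^ a) = aeval (ζ ^ a) P := by
    rw [← hP, ← map_pow]
    rfl
  have hchar_one : π.character g = aeval ζ P := by simpa using hchar 1
  simp only [hchar, hchar_one, exists_rat_aeval_eq_iff hζ]

end RationalValues

section Separation

variable {k : Type u} {Γ : Type v} [Field k] [Group Γ]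

theorem asAlgebraHom_eq_zero_of_trace_eq_zero [IsAlgClosed k] [CharZero k] {z : k[Γ]}
    (hz : ∀ a, z * a = a * z) {V : Type*} [AddCommGroup V] [Module k V] [FiniteDimensional k V]
    (π : Representation k Γ V)
    [π.IsIrreducible] (htrace : LinearMap.trace k V (π.asAlgebraHom z) = 0) :
    π.asAlgebraHom z = 0 := by
  let f : Representation.IntertwiningMap π π := ⟨π.asAlgebraHom z, fun g => by
    rw [← π.asAlgebraHom_of g, ← Module.End.mul_eq_comp, ← Module.End.mul_eq_comp, ← map_mul,
      ← map_mul, hz]⟩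
  obtain ⟨c, hc⟩ :=
    (Representation.IsIrreducible.algebraMap_intertwiningMap_bijective_of_isAlgClosed).2 f
  have hscalar : π.asAlgebraHom z = c • LinearMap.id :=
    (congr_arg Representation.IntertwiningMap.toLinearMap hc).symm
  rw [hscalar, map_smul, LinearMap.trace_id, smul_eq_zero, Nat.cast_eq_zero,
    Module.finrank_zero_iff] at htrace
  rcases htrace with rfl | _
  · rw [hscalar, zero_smul]
  · exact Subsingleton.elim _ _

theorem exists_isIrreducible_of_isSimpleModule (M : Type*) [AddCommGroup M] [Module k M]
    [Module k[Γ] M] [IsScalarTower k k[Γ] M] [FiniteDimensional k M] [IsSimpleModule k[Γ] M] :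
    ∃ (d : ℕ) (π : Representation k Γ (Fin d → k)) (b : M ≃ₗ[k] (Fin d → k)),
      π.IsIrreducible ∧ ∀ (z : k[Γ]) (m : M), π.asAlgebraHom z (b m) = b (z • m) := by
  let b : M ≃ₗ[k] (Fin (Module.finrank k M) → k) := (Module.finBasis k M).equivFun
  let φ : k[Γ] →ₐ[k] Module.End k (Fin (Module.finrank k M) → k) :=
    (b.conjAlgEquiv k).toAlgHom.comp (Algebra.lsmul k k M)
  let π : Representation k Γ (Fin (Module.finrank k M) → k) := (MonoidAlgebra.lift k _ Γ).symm φ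
  have hπ (z : k[Γ]) (m : M) : π.asAlgebraHom z (b m) = b (z • m) := by
    rw [show π.asAlgebraHom = φ from (MonoidAlgebra.lift k _ Γ).apply_symm_apply φ]
    exact congr_arg (fun x => b (z • x)) (b.symm_apply_apply m)
  refine ⟨_, π, b, ?_, hπ⟩
  clear_value π b
  let e : M ≃ₗ[k[Γ]] π.asModule :=
    { b.toAddEquiv.trans π.asModuleEquiv.symm.toAddEquiv with
      map_smul' := fun z m => (congr_arg π.asModuleEquiv.symm (hπ z m)).symm }
  exact (Representation.irreducible_iff_isSimpleModule_asModule π).2 (IsSimpleModule.congr e.symm)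

theorem eq_zero_of_forall_trace_eq_zero [IsAlgClosed k] [CharZero k] [Finite Γ] {z : k[Γ]}
    (hz : ∀ a, z * a = a * z)
    (htrace : ∀ (d : ℕ) (π : Representation k Γ (Fin d → k)), π.IsIrreducible →
      LinearMap.trace k _ (π.asAlgebraHom z) = 0) : z = 0 := by
  have : NeZero (Nat.card Γ : k) := ⟨Nat.cast_ne_zero.2 Nat.card_pos.ne'⟩
  suffices z ∈ Ring.jacobson k[Γ] by rwa [IsSemisimpleRing.jacobson_eq_bot] at this
  rw [Ring.jacobson, Module.jacobson, Submodule.mem_sInf]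
  intro m hm
  have : IsSimpleModule k[Γ] (k[Γ] ⧸ m) := isSimpleModule_iff_isCoatom.2 hm
  have : FiniteDimensional k (k[Γ] ⧸ m) :=
    Module.Finite.of_surjective (m.mkQ.restrictScalars k) m.mkQ_surjective
  obtain ⟨d, π, b, hπ, hb⟩ :=
    exists_isIrreducible_of_isSimpleModule (k := k) (Γ := Γ) (k[Γ] ⧸ m)
  have hsmul : z • m.mkQ 1 = 0 := by
    rw [← b.map_eq_zero_iff, ← hb, asAlgebraHom_eq_zero_of_trace_eq_zero hz π (htrace d π hπ),
      LinearMap.zero_apply]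
  rwa [← map_smul, smul_eq_mul, mul_one, Submodule.mkQ_apply, Submodule.Quotient.mk_eq_zero]
    at hsmul

end Separation

section ConjSum

variable (k : Type*) [CommRing k] {Γ : Type*} [Group Γ] [Fintype Γ]

/-- The sum of `g x g⁻¹` over all `g` in `Γ`, an element of the group algebra of `Γ`. It is the sum
of the conjugacy class of `x` multiplied by the order of the centralizer of `x`. -/
noncomputable def conjSum (x : Γ) : k[Γ] :=
  ∑ g : Γ, MonoidAlgebra.of k Γ (g * x * g⁻¹)

theorem conjSum_mul_comm (x : Γ) (a : k[Γ]) : conjSum k x * a = a * conjSum k x := by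
  induction a using MonoidAlgebra.induction_on with
  | of h =>
    simp only [conjSum, Finset.sum_mul, Finset.mul_sum, ← map_mul]
    exact Fintype.sum_equiv (Equiv.mulLeft h⁻¹) _ _ fun g => congr_arg _ (by simp [mul_assoc])
  | add a b ha hb => rw [mul_add, add_mul, ha, hb]
  | smul r a ha => rw [mul_smul_comm, smul_mul_assoc, ha]

theorem trace_asAlgebraHom_conjSum {k : Type*} [Field k] {V : Type*} [AddCommGroup V] [Module k V]
    (π : Representation k Γ V) (x : Γ) :
    LinearMap.trace k V (π.asAlgebraHom (conjSum k x)) = Fintype.card Γ * π.character x := by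
  simp only [conjSum, map_sum, Representation.asAlgebraHom_of]
  exact (Finset.sum_congr rfl fun g _ => π.char_conj x g).trans (by simp)

theorem coeff_conjSum [DecidableEq Γ] (x y : Γ) :
    (conjSum k x).coeff y = (Finset.univ.filter fun g : Γ => g * x * g⁻¹ = y).card := by
  simp [conjSum, MonoidAlgebra.coeff_sum, Finsupp.finsetSum_apply, Finsupp.single_apply]

theorem isConj_of_conjSum_eq [CharZero k] {x y : Γ} (h : conjSum k x = conjSum k y) :
    IsConj x y := by
  classical
  have hcard := (coeff_conjSum k x y).symm.trans ((congr_arg (·.coeff y) h).trans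
    (coeff_conjSum k y y))
  have hpos : 0 < (Finset.univ.filter fun g : Γ => g * x * g⁻¹ = y).card := by
    rw [Nat.cast_injective hcard]
    exact Finset.card_pos.2 ⟨1, by simp⟩
  obtain ⟨g, hg⟩ := Finset.card_pos.1 hpos
  exact isConj_iff.2 ⟨g, (Finset.mem_filter.1 hg).2⟩

end ConjSum

theorem isConj_of_forall_character_eq {k Γ : Type*} [Field k] [IsAlgClosed k] [CharZero k]
    [Group Γ] [Finite Γ] {x y : Γ}
    (h : ∀ (d : ℕ) (π : Representation k Γ (Fin d → k)), π.IsIrreducible →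
      π.character x = π.character y) : IsConj x y := by
  have := Fintype.ofFinite Γ
  refine isConj_of_conjSum_eq k <| sub_eq_zero.1 <| eq_zero_of_forall_trace_eq_zero
    (fun a => ?_) fun d π hπ => ?_
  · rw [sub_mul, mul_sub, conjSum_mul_comm, conjSum_mul_comm]
  · rw [map_sub, map_sub, trace_asAlgebraHom_conjSum, trace_asAlgebraHom_conjSum, h d π hπ,
      sub_self]

theorem hasRationalCharacterTable_iff {Γ : Type*} [Group Γ] [Finite Γ] :
    HasRationalCharacterTable Γ ↔
      ∀ (y : Γ) (a : ℕ), a.Coprime (Nat.card Γ) → IsConj y (y ^ a) := by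
  refine ⟨fun h y a ha => isConj_of_forall_character_eq (k := ℂ) fun d π hπ => ?_,
    fun h V _ _ _ π _ g => (exists_rat_character_iff π g).2 fun a ha => ?_⟩
  · exact ((exists_rat_character_iff π y).1 (h _ π hπ y) a ha).symm
  · obtain ⟨x, hx⟩ := isConj_iff.1 (h g a ha)
    rw [← hx, π.char_conj]

section Padic

theorem isNonarchimedeanLocalField_of_nontriviallyNormedField (K : Type*)
    [NontriviallyNormedField K] [IsUltrametricDist K] [LocallyCompactSpace K] [ValuativeRel K]
    [(NormedField.valuation (K := K)).Compatible] : IsNonarchimedeanLocalField K where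
  toIsValuativeTopology := .of_mem_nhds_zero_iff_vle NormedField.valuation
    (NormedField.toValued.is_topological_valuation _)
  toIsNontrivial := by
    rw [ValuativeRel.isNontrivial_iff_isNontrivial (NormedField.valuation (K := K))]
    obtain ⟨x, hx⟩ := NormedField.exists_one_lt_norm K
    exact ⟨x, (nnnorm_pos.2 <| norm_pos_iff.1 <| zero_lt_one.trans hx).ne',
      fun h => hx.ne' (congr_arg NNReal.toReal h)⟩

theorem residueCard_eq_of_ringEquiv_padic {K : Type*} [Field K] [ValuativeRel K]
    [TopologicalSpace K] [IsNonarchimedeanLocalField K] {p : ℕ} [Fact p.Prime] (e : K ≃+* ℚ_[p])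
    (he : ∀ x, x ∈ 𝒪[K] ↔ e x ∈ PadicInt.subring p) : residueCard K = p := by
  let eO : 𝒪[K] ≃+* ℤ_[p] := e.restrict 𝒪[K] (PadicInt.subring p) he
  rw [residueCard, Nat.card_congr ((IsLocalRing.ResidueField.mapEquiv eO).trans
    PadicInt.residueField).toEquiv, Nat.card_zmod]

theorem exists_residueCard_eq_of_ringEquiv_padic {K : Type*} [Field K] {p : ℕ} [Fact p.Prime]
    (e : K ≃+* ℚ_[p]) :
    ∃ (_ : ValuativeRel K) (_ : TopologicalSpace K) (_ : IsNonarchimedeanLocalField K),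
      residueCard K = p := by
  let : NormedField K := .induced K ℚ_[p] e e.injective
  let : NontriviallyNormedField K :=
    ⟨(NormedField.exists_one_lt_norm ℚ_[p]).imp' e.symm fun x hx => by
      change 1 < ‖e (e.symm x)‖
      rwa [e.apply_symm_apply]⟩
  have : IsUltrametricDist K :=
    IsUltrametricDist.isUltrametricDist_of_forall_norm_add_le_max_norm fun x y => by
      change ‖e (x + y)‖ ≤ max ‖e x‖ ‖e y‖
      rw [map_add]
      exact Padic.nonarchimedean _ _
  have : LocallyCompactSpace K :=
    (IsometryEquiv.mk e.toEquiv <| AddMonoidHomClass.isometry_of_norm e fun _ => rfl)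
      |>.toHomeomorph.isClosedEmbedding.locallyCompactSpace
  let : ValuativeRel K := .ofValuation NormedField.valuation
  have : (NormedField.valuation (K := K)).Compatible := .ofValuation _
  have := isNonarchimedeanLocalField_of_nontriviallyNormedField K
  refine ⟨_, _, this, residueCard_eq_of_ringEquiv_padic e fun x => ?_⟩
  exact (ValuativeRel.isEquiv (ValuativeRel.valuation K)
    (NormedField.valuation (K := K))).le_one_iff_le_one

theorem exists_residueCard_eq (p : ℕ) [Fact p.Prime] :
    ∃ (K : Type u) (_ : Field K) (_ : ValuativeRel K) (_ : TopologicalSpace K)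
      (_ : IsNonarchimedeanLocalField K), residueCard K = p :=
  ⟨ULift.{u} ℚ_[p], inferInstance, exists_residueCard_eq_of_ringEquiv_padic ULift.ringEquiv⟩

end Padic

section TamePolynomial

variable {Γ : Type*} [Group Γ] [Fintype Γ] [DecidableEq Γ]

/-- The generating polynomial of the solutions `(x, y)` of the tame relation `x y x⁻¹ = y ^ a`,
counted with the weight `w y`. Its value at `1 / q` is the total mass of a local field with
residue cardinality `q ≡ a` modulo `|Γ|`. -/
noncomputable def tamePolynomial (w : Γ → ℕ) (a : ℕ) : ℤ[X] :=
  ∑ p : {p : Γ × Γ // p.1 * p.2 * p.1⁻¹ = p.2 ^ a}, X ^ w p.1.2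

theorem tamePolynomial_eq_sum (w : Γ → ℕ) (a : ℕ) : tamePolynomial w a =
    ∑ y, (Finset.univ.filter fun x : Γ => x * y * x⁻¹ = y ^ a).card • X ^ w y := by
  rw [tamePolynomial, ← Finset.sum_subtype
    (Finset.univ.filter fun p : Γ × Γ => p.1 * p.2 * p.1⁻¹ = p.2 ^ a) (fun p => by simp)
    (fun p => X ^ w p.2), Finset.sum_filter, Fintype.sum_prod_type_right]
  exact Finset.sum_congr rfl fun y _ => by simp only [← Finset.sum_filter, Finset.sum_const]

theorem tamePolynomial_congr (w : Γ → ℕ) {a b : ℕ} (h : a ≡ b [MOD Nat.card Γ]) :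
    tamePolynomial w a = tamePolynomial w b := by
  have hpow (y : Γ) : y ^ a = y ^ b := by rw [← pow_mod_natCard, h, pow_mod_natCard]
  simp only [tamePolynomial_eq_sum, hpow]

theorem card_filter_conj_eq_of_isConj {y z : Γ} (h : IsConj y z) :
    (Finset.univ.filter fun x : Γ => x * y * x⁻¹ = z).card =
      (Finset.univ.filter fun x : Γ => x * y * x⁻¹ = y).card := by
  obtain ⟨g, rfl⟩ := isConj_iff.1 h
  refine Finset.card_equiv (Equiv.mulLeft g⁻¹) fun x => ?_
  simp only [Finset.mem_filter, Finset.mem_univ, true_and, Equiv.coe_mulLeft]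
  simp only [← MulAut.conj_apply]
  rw [map_mul, map_inv, MulAut.mul_apply, MulAut.inv_apply, MulEquiv.symm_apply_eq]

theorem card_filter_conj_le (y z : Γ) :
    (Finset.univ.filter fun x : Γ => x * y * x⁻¹ = z).card ≤
      (Finset.univ.filter fun x : Γ => x * y * x⁻¹ = y).card := by
  by_cases h : IsConj y z
  · exact (card_filter_conj_eq_of_isConj h).le
  · rw [Finset.filter_false_of_mem fun x _ hx => h (isConj_iff.2 ⟨x, hx⟩)]
    exact Nat.zero_le _

theorem card_filter_conj_eq_iff {y z : Γ} :
    (Finset.univ.filter fun x : Γ => x * y * x⁻¹ = z).card =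
      (Finset.univ.filter fun x : Γ => x * y * x⁻¹ = y).card ↔ IsConj y z := by
  refine ⟨fun h => ?_, card_filter_conj_eq_of_isConj⟩
  have hpos : 0 < (Finset.univ.filter fun x : Γ => x * y * x⁻¹ = z).card :=
    h ▸ Finset.card_pos.2 ⟨1, by simp⟩
  obtain ⟨x, hx⟩ := Finset.card_pos.1 hpos
  exact isConj_iff.2 ⟨x, (Finset.mem_filter.1 hx).2⟩

theorem tamePolynomial_eq_tamePolynomial_one_iff (w : Γ → ℕ) (a : ℕ) :
    tamePolynomial w a = tamePolynomial w 1 ↔ ∀ y : Γ, IsConj y (y ^ a) := by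
  refine ⟨fun h y => ?_, fun h => ?_⟩
  · have hsum := congr_arg (eval 1) h
    simp only [tamePolynomial_eq_sum, eval_finsetSum, nsmul_eq_mul, eval_mul, eval_natCast,
      eval_pow, eval_X, one_pow, pow_one, mul_one] at hsum
    exact card_filter_conj_eq_iff.1 <|
      (Finset.sum_eq_sum_iff_of_le fun y _ => card_filter_conj_le y (y ^ a)).1
        (by exact_mod_cast hsum) y (Finset.mem_univ y)
  · simp only [tamePolynomial_eq_sum, pow_one, card_filter_conj_eq_of_isConj (h _)]

end TamePolynomial

theorem eq_of_aeval_one_div_prime_eq (F : Type*) [Field F] [CharZero F] {n a : ℕ} (hn : n ≠ 0)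
    (ha : a.Coprime n) {f g : ℤ[X]} (h : ∀ p : ℕ, p.Prime → p ≡ a [MOD n] →
      aeval (1 / (p : F)) f = aeval (1 / (p : F)) g) : f = g := by
  have hinf : {p : ℕ | p.Prime ∧ p ≡ a [MOD n]}.Infinite :=
    Set.infinite_of_forall_exists_gt fun N => by
      obtain ⟨p, hlt, hp, hmod⟩ := Nat.forall_exists_prime_gt_and_modEq N hn ha
      exact ⟨p, ⟨hp, hmod⟩, hlt⟩
  have hinj : Function.Injective fun p : ℕ => 1 / (p : F) := fun p q hpq => by simpa using hpq
  refine map_injective (Int.castRingHom F) Int.cast_injective <|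
    eq_of_infinite_eval_eq _ _ <| (hinf.image hinj.injOn).mono ?_
  rintro _ ⟨p, ⟨hp, hmod⟩, rfl⟩
  simpa [aeval_def, eval₂_eq_eval_map] using h p hp hmod

theorem exists_tame_equiv (K : Type u) [Field K] [ValuativeRel K] [TopologicalSpace K]
    [IsNonarchimedeanLocalField K] (Γ : Type v) [Group Γ] [Finite Γ] [TopologicalSpace Γ]
    [DiscreteTopology Γ] (hΓ : (residueCard K).Coprime (Nat.card Γ)) :
    ∃ e : (AbsGal K →ₜ* Γ) ≃ {p : Γ × Γ // p.1 * p.2 * p.1⁻¹ = p.2 ^ residueCard K},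
      ∀ ρ : AbsGal K →ₜ* Γ,
        (inertiaGroup K).map (ρ : AbsGal K →* Γ) = Subgroup.zpowers (e ρ).1.2 := by
  obtain ⟨w, h⟩ := exists_isLocalNorm K (SeparableClosure K)
  exact h.exists_tame_equiv Γ hΓ

namespace CountingFunction

variable {Γ : Type v} [Group Γ] [TopologicalSpace Γ] {c : CountingFunction.{u, v} Γ}

theorem IsProper.exists_weight (hc : c.IsProper) :
    ∃ w : Γ → ℕ, ∀ (K : Type u) [Field K] [ValuativeRel K] [TopologicalSpace K]
      [IsNonarchimedeanLocalField K], (residueCard K).Coprime (Nat.card Γ) →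
      ∀ (ρ : AbsGal K →ₜ* Γ) (y : Γ),
        (inertiaGroup K).map (ρ : AbsGal K →* Γ) = Subgroup.zpowers y → c.toFun ρ = w y := by
  suffices h : ∀ y : Γ, ∃ m : ℕ, ∀ (K : Type u) [Field K] [ValuativeRel K] [TopologicalSpace K]
      [IsNonarchimedeanLocalField K], (residueCard K).Coprime (Nat.card Γ) →
      ∀ ρ : AbsGal K →ₜ* Γ,
        (inertiaGroup K).map (ρ : AbsGal K →* Γ) = Subgroup.zpowers y → c.toFun ρ = m by
    choose w hw using h
    exact ⟨w, fun K _ _ _ _ hK ρ y hρ => hw y K hK ρ hρ⟩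
  intro y
  by_cases h : ∃ (K : Type u) (_ : Field K) (_ : ValuativeRel K) (_ : TopologicalSpace K)
      (_ : IsNonarchimedeanLocalField K) (ρ : AbsGal K →ₜ* Γ),
      (residueCard K).Coprime (Nat.card Γ) ∧
        (inertiaGroup K).map (ρ : AbsGal K →* Γ) = Subgroup.zpowers y
  · obtain ⟨K', _, _, _, _, ρ', hK', hρ'⟩ := h
    exact ⟨c.toFun ρ', fun K _ _ _ _ hK ρ hρ => hc K K' ρ ρ' hK hK' (hρ.trans hρ'.symm)⟩
  · exact ⟨0, fun K _ _ _ _ hK ρ hρ => (h ⟨K, _, _, _, _, ρ, hK, hρ⟩).elim⟩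

theorem IsProper.exists_totalMass_eq [Fintype Γ] [DecidableEq Γ] [DiscreteTopology Γ]
    (hc : c.IsProper) :
    ∃ w : Γ → ℕ, ∀ (K : Type u) [Field K] [ValuativeRel K] [TopologicalSpace K]
      [IsNonarchimedeanLocalField K], (residueCard K).Coprime (Nat.card Γ) →
      c.totalMass K ≠ ∞ ∧ (c.totalMass K).toReal =
        aeval (1 / (residueCard K : ℝ)) (tamePolynomial w (residueCard K)) := by
  obtain ⟨w, hw⟩ := hc.exists_weight
  refine ⟨w, fun K _ _ _ _ hK => ?_⟩
  obtain ⟨e, he⟩ := exists_tame_equiv K Γ hK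
  have hq : residueCard K ≠ 0 := (Nat.card_pos (α := 𝓀[K])).ne'
  have hmass : c.totalMass K =
      ∑ p : {p : Γ × Γ // p.1 * p.2 * p.1⁻¹ = p.2 ^ residueCard K},
        ((residueCard K : ℝ≥0∞) ^ w p.1.2)⁻¹ := by
    rw [totalMass, ← tsum_fintype (L := SummationFilter.unconditional _), ← e.tsum_eq]
    exact tsum_congr fun ρ => by rw [hw K hK ρ _ (he ρ)]
  have hfin (m : ℕ) : ((residueCard K : ℝ≥0∞) ^ m)⁻¹ ≠ ∞ :=
    ENNReal.inv_ne_top.2 (pow_ne_zero _ (Nat.cast_ne_zero.2 hq))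
  rw [hmass]
  refine ⟨ENNReal.sum_ne_top.2 fun p _ => hfin _, ?_⟩
  rw [ENNReal.toReal_sum fun p _ => hfin _, tamePolynomial, map_sum]
  exact Finset.sum_congr rfl fun p _ => by simp

end CountingFunction

theorem mainTheorem4 {Γ : Type v} [Group Γ] [Finite Γ] [TopologicalSpace Γ] [DiscreteTopology Γ]
    (c : CountingFunction.{u, v} Γ) (hc : c.IsProper) :
    c.HasMassFormula (fun K _ _ _ _ => (residueCard K).Coprime (Nat.card Γ)) ↔
      HasRationalCharacterTable Γ := by
  classical
  have := Fintype.ofFinite Γ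
  obtain ⟨w, hmass⟩ := hc.exists_totalMass_eq
  rw [hasRationalCharacterTable_iff]
  refine ⟨fun ⟨f, hf⟩ => ?_, fun hconj => ⟨tamePolynomial w 1, fun K _ _ _ _ hK => ?_⟩⟩
  · have hpoly (a : ℕ) (ha : a.Coprime (Nat.card Γ)) : tamePolynomial w a = f := by
      refine eq_of_aeval_one_div_prime_eq ℝ Nat.card_pos.ne' ha fun p hp hpa => ?_
      have : Fact p.Prime := ⟨hp⟩
      obtain ⟨K, _, _, _, _, rfl⟩ := exists_residueCard_eq.{u} p
      have hcop : (residueCard K).Coprime (Nat.card Γ) := hpa.gcd_eq.trans ha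
      rw [← tamePolynomial_congr w hpa, ← (hmass K hcop).2, (hf K hcop).2]
    exact fun y a ha => (tamePolynomial_eq_tamePolynomial_one_iff w a).1
      ((hpoly a ha).trans (hpoly 1 (Nat.coprime_one_left _)).symm) y
  · rw [← (tamePolynomial_eq_tamePolynomial_one_iff w (residueCard K)).2 fun y => hconj y _ hK]
    exact hmass K hK
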